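/- Let $n\ge 1$. On $\mathbb R^{2n+1}$ let $\eta_0=dx^{2n+1}-\sum_{j=1}^n x^{n+j}dx^j$, let $X_j=\partial_{x^j}+x^{n+j}\partial_{x^{2n+1}}$ and $X_{n+j}=\partial_{x^{n+j}}$ $(1\le j\le n)$ be the standard frame of $\ker\eta_0$, and for $I=(i_1,\dots,i_t)$, $1\le i_k\le 2n$, put $|I|=t$ and $X_I=X_{i_1}\cdots X_{i_t}$. For a bounded open set $D\subset\mathbb R^{2n+1}$ and $s\in\{0,1,2,\dots\}$ the Folland–Stein space $\Gamma^s(D)$ is the Hilbert space completion of the real-valued smooth functions on $\overline D$ with respect to $$(f,g)_{D,s}=\sum_{0\le |I|\le s}\int_D X_If\,X_Ig\;dV_0,\qquad dV_0=\tfrac1{n!}\,\eta_0\wedge(d\eta_0)^n ,$$ with norm $\|\cdot\|_{D,s}$; its elements are regarded as functions in $L^2(D)$. Let $M$ be a smooth compact manifold of dimension $2n+1$ with a contact form $\eta$. An adapted atlas of $M$ consists of finitely many smooth charts $\phi_\alpha:U_\alpha\to\mathbb R^{2n+1}$ with $\eta=\phi_\alpha^*\eta_0$ and open sets $D_\alpha\Subset\phi_\alpha(U_\alpha)$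 such that the sets $\phi_\alpha^{-1}(D_\alpha)$ cover $M$. Given an adapted atlas, $\Gamma^s(M)$ is the space of functions $f:M\to\mathbb R$ with $f_\alpha=f\circ\phi_\alpha^{-1}\in\Gamma^s(D_\alpha)$ for all $\alpha$, with the norm $\|f\|_{M,s}^2=\sum_\alpha\|f_\alpha\|_{D_\alpha,s}^2$. **Local estimate.** Let $D'\Subset D\Subset\mathbb R^{2n+1}$ be open, $s\ge 2n+4$ and $p\ge1$. There is a constant $C>0$ (independent of the $f_j$) such that, for all $f_1,\dots,f_p\in\Gamma^s(D)$, the product $f_1\cdots f_p$ lies in $\Gamma^s(D')$ and $$\|f_1\cdots f_p\|_{D',s}\le C\,\|f_1\|_{D,s}\cdots\|f_p\|_{D,s}.$$ If moreover $s>2n+4$, there is a constant $C>0$ such that, for all $f_1,\dots,f_p\in\Gamma^s(D)$, $$\|f_1\cdots f_p\|_{D',s}\le C\sum_{j=1}^p\|f_j\|_{D,s}\prod_{i\ne j}\|f_i\|_{D,s-1}.$$ **Global estimate.** Let $s\ge 2n+4$ and $p\ge1$, and fix an adapted atlas of $M$. There is a constant $C>0$ such that, for all $f_1,\dots,f_p\in\Gamma^s(M)$,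 the product $f_1\cdots f_p$ lies in $\Gamma^s(M)$ (so $\Gamma^s(M)$ is closed under multiplication) and $$\|f_1\cdots f_p\|_{M,s}\le C\,\|f_1\|_{M,s}\cdots\|f_p\|_{M,s}.$$ If moreover $s>2n+4$, there is a constant $C>0$ such that, for all $f_1,\dots,f_p\in\Gamma^s(M)$, $$\|f_1\cdots f_p\|_{M,s}\le C\sum_{j=1}^p\|f_j\|_{M,s}\prod_{i\ne j}\|f_i\|_{M,s-1}.$$ -/

import Mathlib

open Set MeasureTheory Manifold
open scoped ContDiff

noncomputable section

namespace FollandStein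

/-! ### The standard contact structure on `ℝ^{2n+1}` -/

/-- Euclidean space `ℝ^{2n+1}`, with coordinates `x^1, …, x^{2n+1}` (numbered from `0` here). -/
abbrev Space (n : ℕ) : Type := EuclideanSpace ℝ (Fin (2 * n + 1))

/-- The position of the coordinate `x^j`, `1 ≤ j ≤ n`. -/
def idxX {n : ℕ} (j : Fin n) : Fin (2 * n + 1) := ⟨j, by omega⟩

/-- The position of the coordinate `x^{n+j}`, `1 ≤ j ≤ n`. -/
def idxY {n : ℕ} (j : Fin n) : Fin (2 * n + 1) := ⟨n + j, by omega⟩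

/-- The position of the last coordinate `x^{2n+1}`. -/
def idxT (n : ℕ) : Fin (2 * n + 1) := Fin.last (2 * n)

/-- The standard contact form `η₀ = dx^{2n+1} - ∑_j x^{n+j} dx^j`. -/
def stdForm {n : ℕ} (x : Space n) : Space n →L[ℝ] ℝ :=
  EuclideanSpace.proj (idxT n) - ∑ j : Fin n, x (idxY j) • EuclideanSpace.proj (idxX j)

/-- Indices of the standard horizontal frame: `inl j` stands for `X_j`, `inr j` for `X_{n+j}`. -/
abbrev FrameIdx (n : ℕ) : Type := Fin n ⊕ Fin n

/-- The standard horizontal frame, `X_j = ∂/∂x^j + x^{n+j} ∂/∂x^{2n+1}` and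
`X_{n+j} = ∂/∂x^{n+j}`. -/
def frame {n : ℕ} : FrameIdx n → Space n → Space n
  | .inl j, x => EuclideanSpace.single (idxX j) 1 + x (idxY j) • EuclideanSpace.single (idxT n) 1
  | .inr j, _ => EuclideanSpace.single (idxY j) 1

/-- The iterated horizontal derivative `X_I φ = X_{i₁} X_{i₂} ⋯ X_{i_t} φ`. -/
def horDeriv {n : ℕ} : List (FrameIdx n) → (Space n → ℝ) → Space n → ℝ
  | [], φ => φ
  | i :: I, φ => fun x => fderiv ℝ (horDeriv I φ) x (frame i x)

/-- Multi-indices `I = (i₁, …, i_t)` of order `|I| = t ≤ s`. -/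
abbrev MultiIdx (n s : ℕ) : Type := {I : List (FrameIdx n) // I.length ≤ s}

instance (n s : ℕ) : Finite (MultiIdx n s) := (List.finite_length_le (FrameIdx n) s).to_subtype

instance (n s : ℕ) : Fintype (MultiIdx n s) := Fintype.ofFinite _

/-- The empty multi-index. -/
def emptyIdx (n s : ℕ) : MultiIdx n s := ⟨[], Nat.zero_le s⟩

/-! ### Folland–Stein spaces of functions on bounded open sets -/

/-- The Hilbert space `⨁_{|I| ≤ s} L²(D)`. The volume form `dV₀ = η₀ ∧ (dη₀)^n / n!` is the
Euclidean volume form up to sign, so `L²(D)` is taken with respect to Lebesgue measure. -/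
abbrev JetL2 {n : ℕ} (D : Set (Space n)) (s : ℕ) : Type :=
  PiLp 2 (fun _ : MultiIdx n s => Lp ℝ 2 (volume.restrict D))

lemma horDeriv_contDiff {n : ℕ} (I : List (FrameIdx n)) {φ : Space n → ℝ}
    (hφ : ContDiff ℝ ∞ φ) : ContDiff ℝ ∞ (horDeriv I φ) := by
  induction I with
  | nil => exact hφ
  | cons i I ih =>
    have h1 : ContDiff ℝ ∞ (fderiv ℝ (horDeriv I φ)) :=
      ih.fderiv_right (m := ∞) (by simp)
    have h2 : ContDiff ℝ ∞ (frame (n := n) i) := by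
      cases i with
      | inl j =>
        have : ContDiff ℝ ∞ (fun x : Space n => x (idxY j)) :=
          (EuclideanSpace.proj (𝕜 := ℝ) (idxY j)).contDiff
        exact contDiff_const.add (this.smul contDiff_const)
      | inr j => exact contDiff_const
    exact h1.clm_apply h2

lemma horDeriv_add {n : ℕ} (I : List (FrameIdx n)) {φ ψ : Space n → ℝ}
    (hφ : ContDiff ℝ ∞ φ) (hψ : ContDiff ℝ ∞ ψ) :
    horDeriv I (φ + ψ) = horDeriv I φ + horDeriv I ψ := by
  induction I with
  | nil => rfl
  | cons i I ih =>
    funext x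
    simp only [horDeriv, ih, Pi.add_apply]
    rw [fderiv_add ((horDeriv_contDiff I hφ).differentiable (by simp) x)
      ((horDeriv_contDiff I hψ).differentiable (by simp) x)]
    rfl

lemma horDeriv_smul {n : ℕ} (I : List (FrameIdx n)) (c : ℝ) {φ : Space n → ℝ}
    (hφ : ContDiff ℝ ∞ φ) : horDeriv I (c • φ) = c • horDeriv I φ := by
  induction I with
  | nil => rfl
  | cons i I ih =>
    funext x
    simp only [horDeriv, ih, Pi.smul_apply]
    rw [fderiv_const_smul ((horDeriv_contDiff I hφ).differentiable (by simp) x)]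
    rfl

/-- The families `(X_I φ)_{|I| ≤ s}` in `⨁_{|I| ≤ s} L²(D)`, for `φ` smooth on the closure of `D`,
that is, the restriction of a smooth function on `ℝ^{2n+1}`. -/
def smoothJets {n : ℕ} (D : Set (Space n)) (s : ℕ) : Submodule ℝ (JetL2 D s) where
  carrier := {F | ∃ φ : Space n → ℝ, ContDiff ℝ ∞ φ ∧
    ∀ I : MultiIdx n s, F I =ᵐ[volume.restrict D] horDeriv I.1 φ}
  add_mem' := by
    rintro F G ⟨φ, hφ, hF⟩ ⟨ψ, hψ, hG⟩
    refine ⟨φ + ψ, hφ.add hψ, fun I => ?_⟩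
    rw [horDeriv_add I.1 hφ hψ, PiLp.add_apply]
    exact (Lp.coeFn_add _ _).trans ((hF I).add (hG I))
  zero_mem' := by
    refine ⟨0, contDiff_const, fun I => ?_⟩
    have h0 : horDeriv I.1 (0 : Space n → ℝ) = 0 := by
      have := horDeriv_smul I.1 (0 : ℝ) (φ := (0 : Space n → ℝ)) contDiff_const
      simpa using this
    rw [h0, PiLp.zero_apply]
    exact Lp.coeFn_zero _ _ _
  smul_mem' := by
    rintro c F ⟨φ, hφ, hF⟩
    refine ⟨c • φ, hφ.const_smul c, fun I => ?_⟩
    rw [horDeriv_smul I.1 c hφ, PiLp.smul_apply]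
    exact (Lp.coeFn_smul _ _).trans ((hF I).const_smul c)

/-- The Folland–Stein space `Γ^s(D)`: the Hilbert space completion of the smooth functions on the
closure of `D` for `(f, g)_{D,s} = ∑_{|I| ≤ s} ∫_D X_I f · X_I g dV₀`. It is realized as the closure
of the families `(X_I φ)_{|I| ≤ s}` in `⨁_{|I| ≤ s} L²(D)`, with the norm and the inner product of
that space. The function that an element `F` stands for is its component `F_∅ ∈ L²(D)`, and `F_I`
is the horizontal derivative `X_I` of that function. -/
def fsSpace {n : ℕ} (D : Set (Space n)) (s : ℕ) : Submodule ℝ (JetL2 D s) :=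
  (smoothJets D s).topologicalClosure

/-- The function `f` represents an element of `Γ^s(D)`; values outside `D` are immaterial. -/
def MemFS {n : ℕ} (D : Set (Space n)) (s : ℕ) (f : Space n → ℝ) : Prop :=
  ∃ F ∈ fsSpace D s, F (emptyIdx n s) =ᵐ[volume.restrict D] f

open Classical in
/-- The norm `‖f‖_{D,s}` of a function `f` in `Γ^s(D)`, with value `0` at all other functions. The
element `F` chosen here is unique for open `D`, see `fsNorm_eq`. -/
def fsNorm {n : ℕ} (D : Set (Space n)) (s : ℕ) (f : Space n → ℝ) : ℝ :=
  if h : MemFS D s f then ‖h.choose‖ else 0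

/-- Integration by parts along the horizontal frame. -/
lemma exists_adjoint {n : ℕ} (D : Set (Space n)) (I : List (FrameIdx n)) (ψ : Space n → ℝ)
    (hψ : ContDiff ℝ ∞ ψ) (hc : HasCompactSupport ψ) (hs : tsupport ψ ⊆ D) :
    ∃ ψ' : Space n → ℝ, ContDiff ℝ ∞ ψ' ∧ HasCompactSupport ψ' ∧ tsupport ψ' ⊆ D ∧
      ∀ φ : Space n → ℝ, ContDiff ℝ ∞ φ → ∫ x, horDeriv I φ x * ψ x = ∫ x, φ x * ψ' x := by
  induction I generalizing ψ with
  | nil => exact ⟨ψ, hψ, hc, hs, fun φ _ => rfl⟩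
  | cons i I ih =>
    have key : ∀ (φ χ : Space n → ℝ) (v : Space n), ContDiff ℝ ∞ φ → ContDiff ℝ ∞ χ →
        HasCompactSupport χ →
        Integrable (fun x => fderiv ℝ φ x v * χ x) ∧
        ∫ x, fderiv ℝ φ x v * χ x = ∫ x, φ x * (-fderiv ℝ χ x v) := by
      intro φ χ v hφ hχ hcχ
      have c1 : Continuous (fun x => fderiv ℝ φ x v) :=
        (hφ.continuous_fderiv (by simp)).clm_apply continuous_const
      have c2 : Continuous (fun x => fderiv ℝ χ x v) :=
        (hχ.continuous_fderiv (by simp)).clm_apply continuous_const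
      have i1 : Integrable (fun x => fderiv ℝ φ x v * χ x) :=
        (c1.mul hχ.continuous).integrable_of_hasCompactSupport hcχ.mul_left
      have i2 : Integrable (fun x => φ x * fderiv ℝ χ x v) :=
        (hφ.continuous.mul c2).integrable_of_hasCompactSupport
          ((hcχ.fderiv_apply (𝕜 := ℝ) v).mul_left)
      have i3 : Integrable (fun x => φ x * χ x) :=
        (hφ.continuous.mul hχ.continuous).integrable_of_hasCompactSupport hcχ.mul_left
      refine ⟨i1, ?_⟩
      have := integral_mul_fderiv_eq_neg_fderiv_mul_of_integrable i1 i2 i3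
        (fun x _ => hφ.differentiable (by simp) x) (fun x _ => hχ.differentiable (by simp) x)
      simp only [mul_neg, integral_neg]
      linarith
    have dsupp : ∀ (χ : Space n → ℝ) (v : Space n), tsupport (fun x => -fderiv ℝ χ x v) ⊆
        tsupport χ := by
      intro χ v
      refine closure_minimal ?_ (isClosed_tsupport _)
      intro x hx
      by_contra hcon
      have h0 : fderiv ℝ χ x = 0 := by
        by_contra h1
        exact hcon (support_fderiv_subset ℝ (f := χ) h1)
      simp [h0] at hx
    have dsmooth : ∀ (χ : Space n → ℝ) (v : Space n), ContDiff ℝ ∞ χ →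
        ContDiff ℝ ∞ (fun x => -fderiv ℝ χ x v) := fun χ v hχ =>
      ((hχ.fderiv_right (m := ∞) (by simp)).clm_apply contDiff_const).neg
    have hcD : ∀ (χ : Space n → ℝ), tsupport χ ⊆ tsupport ψ → HasCompactSupport χ := fun χ h =>
      hc.of_isClosed_subset (isClosed_tsupport _) h
    cases i with
    | inr j =>
      obtain ⟨ψ', h1, h2, h3, h4⟩ := ih
        (fun x => -fderiv ℝ ψ x (EuclideanSpace.single (idxY j) 1)) (dsmooth ψ _ hψ)
        (hcD _ (dsupp ψ _)) ((dsupp ψ _).trans hs)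
      refine ⟨ψ', h1, h2, h3, fun φ hφ => ?_⟩
      rw [← h4 φ hφ]
      exact (key (horDeriv I φ) ψ _ (horDeriv_contDiff I hφ) hψ hc).2
    | inl j =>
      have ha : ContDiff ℝ ∞ (fun x : Space n => x (idxY j)) :=
        (EuclideanSpace.proj (𝕜 := ℝ) (idxY j)).contDiff
      set aψ : Space n → ℝ := fun x => x (idxY j) * ψ x with haψ
      have hsub : tsupport aψ ⊆ tsupport ψ :=
        closure_mono (Function.support_mul_subset_right (fun x : Space n => x (idxY j)) ψ)
      have haψs : ContDiff ℝ ∞ aψ := ha.mul hψ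
      set g : Space n → ℝ := fun x => -fderiv ℝ ψ x (EuclideanSpace.single (idxX j) 1)
        + -fderiv ℝ aψ x (EuclideanSpace.single (idxT n) 1) with hg
      have hgs : tsupport g ⊆ tsupport ψ :=
        (tsupport_add _ _).trans (union_subset (dsupp ψ _) ((dsupp aψ _).trans hsub))
      obtain ⟨ψ', h1, h2, h3, h4⟩ := ih g ((dsmooth ψ _ hψ).add (dsmooth aψ _ haψs))
        (hcD _ hgs) (hgs.trans hs)
      refine ⟨ψ', h1, h2, h3, fun φ hφ => ?_⟩
      rw [← h4 φ hφ]
      have hφI := horDeriv_contDiff I hφ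
      have k1 := key (horDeriv I φ) ψ (EuclideanSpace.single (idxX j) 1) hφI hψ hc
      have k2 := key (horDeriv I φ) aψ (EuclideanSpace.single (idxT n) 1) hφI haψs (hcD _ hsub)
      have e1 : (fun x => horDeriv (Sum.inl j :: I) φ x * ψ x) = fun x =>
          fderiv ℝ (horDeriv I φ) x (EuclideanSpace.single (idxX j) 1) * ψ x +
          fderiv ℝ (horDeriv I φ) x (EuclideanSpace.single (idxT n) 1) * aψ x := by
        funext x
        simp only [horDeriv, frame, map_add, map_smul, smul_eq_mul, haψ]
        ring
      have e2 : (fun x => horDeriv I φ x * g x) = fun x =>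
          horDeriv I φ x * (-fderiv ℝ ψ x (EuclideanSpace.single (idxX j) 1)) +
          horDeriv I φ x * (-fderiv ℝ aψ x (EuclideanSpace.single (idxT n) 1)) := by
        funext x
        simp only [hg]
        ring
      have int : ∀ (χ : Space n → ℝ) (v : Space n), ContDiff ℝ ∞ χ → tsupport χ ⊆ tsupport ψ →
          Integrable (fun x => horDeriv I φ x * (-fderiv ℝ χ x v)) := fun χ v hχ hsχ =>
        (hφI.continuous.mul (dsmooth χ v hχ).continuous).integrable_of_hasCompactSupport
          (hcD _ ((dsupp χ v).trans hsχ)).mul_left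
      rw [e1, e2, integral_add k1.1 k2.1, integral_add (int ψ _ hψ subset_rfl) (int aψ _ haψs hsub),
        k1.2, k2.2]

/-- An element of `Γ^s(D)` is determined by the function that it stands for. -/
lemma fsSpace_ext {n : ℕ} {D : Set (Space n)} (hD : IsOpen D) {s : ℕ} {F G : JetL2 D s}
    (hF : F ∈ fsSpace D s) (hG : G ∈ fsSpace D s)
    (h : F (emptyIdx n s) = G (emptyIdx n s)) : F = G := by
  suffices H : ∀ K ∈ fsSpace D s, K (emptyIdx n s) = 0 → K = 0 by
    refine sub_eq_zero.mp (H (F - G) (Submodule.sub_mem _ hF hG) ?_)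
    rw [PiLp.sub_apply, h, sub_self]
  intro K hK hK0
  ext1 I
  change K I = 0
  have test : ∀ ψ : Space n → ℝ, ContDiff ℝ ∞ ψ → HasCompactSupport ψ → tsupport ψ ⊆ D →
      ∫ x, ψ x * K I x ∂(volume.restrict D) = 0 := by
    intro ψ hψ hc hs
    obtain ⟨ψ', h1, h2, h3, h4⟩ := exists_adjoint D I.1 ψ hψ hc hs
    have m : MemLp ψ 2 (volume.restrict D) :=
      (hψ.continuous.memLp_of_hasCompactSupport hc).restrict D
    have m' : MemLp ψ' 2 (volume.restrict D) :=
      (h1.continuous.memLp_of_hasCompactSupport h2).restrict D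
    have pair : ∀ (χ : Space n → ℝ) (hχ : MemLp χ 2 (volume.restrict D))
        (f : Lp ℝ 2 (volume.restrict D)),
        inner ℝ (hχ.toLp χ) f = ∫ x, χ x * f x ∂(volume.restrict D) := by
      intro χ hχ f
      rw [L2.inner_def]
      refine integral_congr_ae ?_
      filter_upwards [hχ.coeFn_toLp] with x hx
      rw [hx]
      simp [mul_comm]
    have closed : IsClosed {F : JetL2 D s | inner ℝ (m.toLp ψ) (F I) =
        inner ℝ (m'.toLp ψ') (F (emptyIdx n s))} := by
      refine isClosed_eq ?_ ?_
      · exact continuous_const.inner (PiLp.continuous_apply 2 _ I)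
      · exact continuous_const.inner (PiLp.continuous_apply 2 _ (emptyIdx n s))
    have sub : (smoothJets D s : Set (JetL2 D s)) ⊆ {F : JetL2 D s | inner ℝ (m.toLp ψ) (F I) =
        inner ℝ (m'.toLp ψ') (F (emptyIdx n s))} := by
      rintro F ⟨φ, hφ, hF⟩
      have full : ∀ (u χ : Space n → ℝ), tsupport χ ⊆ D →
          ∫ x in D, χ x * u x = ∫ x, u x * χ x := by
        intro u χ hχ
        simp only [mul_comm (χ _)]
        refine setIntegral_eq_integral_of_forall_compl_eq_zero fun x hx => ?_
        rw [image_eq_zero_of_notMem_tsupport (fun hx' => hx (hχ hx')), mul_zero]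
      have e1 : ∫ x in D, ψ x * F I x = ∫ x in D, ψ x * horDeriv I.1 φ x :=
        integral_congr_ae (by filter_upwards [hF I] with x hx; rw [hx])
      have e2 : ∫ x in D, ψ' x * F (emptyIdx n s) x = ∫ x in D, ψ' x * φ x :=
        integral_congr_ae (by
          filter_upwards [hF (emptyIdx n s)] with x hx
          rw [hx]
          rfl)
      change inner ℝ _ _ = inner ℝ _ _
      rw [pair, pair, e1, e2, full _ _ hs, full _ _ h3]
      exact h4 φ hφ
    have := closure_minimal sub closed hK
    change inner ℝ _ _ = inner ℝ _ _ at this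
    rw [pair, hK0, inner_zero_right] at this
    exact this
  have hloc : LocallyIntegrableOn (K I) D volume := by
    have : LocallyIntegrable (K I) (volume.restrict D) :=
      (Lp.memLp (K I)).locallyIntegrable (by norm_num)
    exact locallyIntegrableOn_of_locallyIntegrable_restrict this
  have := hD.ae_eq_zero_of_integral_contDiff_smul_eq_zero hloc (fun g hg hgc hgs => by
    rw [← test g hg hgc hgs]
    refine (setIntegral_eq_integral_of_forall_compl_eq_zero fun x hx => ?_).symm
    rw [image_eq_zero_of_notMem_tsupport (fun hx' => hx (hgs hx')), zero_smul])
  refine Lp.ext ?_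
  refine Filter.EventuallyEq.trans ?_ (Lp.coeFn_zero _ _ _).symm
  exact (ae_restrict_iff' hD.measurableSet).mpr this

/-- `fsNorm` is the norm of the Hilbert space `Γ^s(D)`. -/
lemma fsNorm_eq {n : ℕ} {D : Set (Space n)} (hD : IsOpen D) {s : ℕ} {f : Space n → ℝ}
    {F : JetL2 D s} (hF : F ∈ fsSpace D s)
    (hf : F (emptyIdx n s) =ᵐ[volume.restrict D] f) : fsNorm D s f = ‖F‖ := by
  have h : MemFS D s f := ⟨F, hF, hf⟩
  rw [fsNorm, dif_pos h]
  exact congrArg _ (fsSpace_ext hD h.choose_spec.1 hF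
    (Lp.ext (h.choose_spec.2.trans hf.symm)))

/-! ### Compact contact manifolds and their Folland–Stein spaces -/

section Contact

variable {n : ℕ} {M : Type*} [TopologicalSpace M] [ChartedSpace (Space n) M]

/-- A one-form on `M`, that is, a covector at every point. -/
abbrev OneForm (n : ℕ) (M : Type*) [TopologicalSpace M] [ChartedSpace (Space n) M] : Type _ :=
  ∀ x : M, TangentSpace (𝓡 (2 * n + 1)) x →L[ℝ] ℝ

/-- The representation `(φ⁻¹)^* η` of a one-form `η` in a chart `φ`. -/
def OneForm.inChart (η : OneForm n M) (φ : OpenPartialHomeomorph M (Space n)) (y : Space n) :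
    Space n →L[ℝ] ℝ :=
  (η (φ.symm y)).comp (mfderiv (𝓡 (2 * n + 1)) (𝓡 (2 * n + 1)) φ.symm y)

/-- The exterior derivative `dθ(v, w)` at `y` of a one-form `θ` on an open set of `ℝ^{2n+1}`. -/
def dForm (θ : Space n → Space n →L[ℝ] ℝ) (y v w : Space n) : ℝ :=
  fderiv ℝ θ y v w - fderiv ℝ θ y w v

/-- The one-form `η` is a contact form: it is smooth and `η ∧ (dη)^n` vanishes nowhere, that is,
`η` vanishes nowhere and `dη` is nondegenerate on `H = ker η`. Both are read off in charts. -/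
structure IsContactForm (η : OneForm n M) : Prop where
  smooth : ∀ φ ∈ IsManifold.maximalAtlas (𝓡 (2 * n + 1)) ∞ M,
    ContDiffOn ℝ ∞ (η.inChart φ) φ.target
  ne_zero : ∀ x : M, η x ≠ 0
  nondegenerate : ∀ φ ∈ IsManifold.maximalAtlas (𝓡 (2 * n + 1)) ∞ M, ∀ y ∈ φ.target,
    ∀ v : Space n, η.inChart φ y v = 0 →
      (∀ w : Space n, η.inChart φ y w = 0 → dForm (η.inChart φ) y v w = 0) → v = 0

/-- An adapted coordinate chart: a smooth chart `φ` of `M` with `η = φ^* η₀`. -/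
def IsAdaptedChart (η : OneForm n M) (φ : OpenPartialHomeomorph M (Space n)) : Prop :=
  φ ∈ IsManifold.maximalAtlas (𝓡 (2 * n + 1)) ∞ M ∧
    ∀ x ∈ φ.source,
      η x = (stdForm (φ x)).comp (mfderiv (𝓡 (2 * n + 1)) (𝓡 (2 * n + 1)) φ x)

/-- An adapted atlas: finitely many adapted charts `φ_α : U_α → ℝ^{2n+1}`, with open sets
`D_α ⋐ φ_α(U_α)` such that the sets `φ_α⁻¹(D_α)` cover `M`. -/
structure AdaptedAtlas (η : OneForm n M) where
  card : ℕ
  chart : Fin card → OpenPartialHomeomorph M (Space n)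
  adapted : ∀ α, IsAdaptedChart η (chart α)
  dom : Fin card → Set (Space n)
  isOpen_dom : ∀ α, IsOpen (dom α)
  isCompact_closure : ∀ α, IsCompact (closure (dom α))
  closure_subset : ∀ α, closure (dom α) ⊆ (chart α).target
  cover : ∀ x : M, ∃ α, x ∈ (chart α).source ∧ chart α x ∈ dom α

/-- The function `f` on `M` is a `Γ^s`-function: all `f_α = f ∘ φ_α⁻¹` lie in `Γ^s(D_α)`. -/
def AdaptedAtlas.MemFS {η : OneForm n M} (A : AdaptedAtlas η) (s : ℕ) (f : M → ℝ) : Prop :=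
  ∀ α, FollandStein.MemFS (A.dom α) s (f ∘ (A.chart α).symm)

/-- The norm `‖f‖_{M,s}`, with `‖f‖_{M,s}² = ∑_α ‖f_α‖_{D_α,s}²`. -/
def AdaptedAtlas.fsNorm {η : OneForm n M} (A : AdaptedAtlas η) (s : ℕ) (f : M → ℝ) : ℝ :=
  Real.sqrt (∑ α, FollandStein.fsNorm (A.dom α) s (f ∘ (A.chart α).symm) ^ 2)

end Contact

end FollandStein

end

noncomputable section

namespace FollandStein

variable {n : ℕ}

/-! ### Algebra of horizontal derivatives -/

/-! By the Leibniz rule, `X_I (f₁ ⋯ f_p)` with `|I| ≤ s` is a sum of products of horizontal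
derivatives of the factors, of total order `|I|`. In each product at most one factor carries more
than `s / 2` derivatives. That factor stays in `L²`; all others are bounded uniformly by a Sobolev
inequality that costs `n + 2` horizontal derivatives, hence by the norm of order `s / 2 + n + 2`.
This order is at most `s` if `s ≥ 2n + 4`, and at most `s - 1` if `s > 2n + 4`, so both estimates
are instances of a single one with an auxiliary order `s'` (`exists_norm_jet_prod_le`).

The Sobolev inequality (`exists_sobolev`) reflects that the homogeneous dimension is `2n + 2` and
that `n + 2` exceeds half of it. Let `G(r)` be the average of `h` against a fixed test function over
the unit ball dilated by `r` and translated to `p`, so that `G(0) = h(p)`. The velocity of the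
dilation is a horizontal vector plus `r` times a vertical one. The vertical field is a commutator of
two horizontal fields, and the factor `r` allows one of the two to be integrated by parts onto the
test function. Hence `G^(k)` consists of averages of horizontal derivatives of order exactly `k`,
without negative powers of `r`. Cauchy–Schwarz and the Jacobian `r^(2n+2)` bound it by `r^(-(n+1))`
times `L²` norms, and in the remainder of Taylor's formula of order `n + 2` the factor `r^(n+1)`
compensates this singularity.

Both steps are carried out for smooth functions. Multilinearity turns the product estimate into
convergence of products of approximating sequences, and almost everywhere convergence identifies the
limit with the product of the given functions (`exists_fsNorm_prod_le`).

On `M` the local estimate requires a smaller domain `D'`, so the product is split by a partition of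
unity subordinate to the sets `φ_α⁻¹(D_α)`. Each piece is estimated in its own chart and transported
to the others. Transitions between adapted charts preserve `η₀`, so they turn horizontal derivatives
into combinations of horizontal derivatives of no higher order (`exists_horDeriv_comp`,
`exists_fsNorm_comp_le`). -/

lemma horDeriv_append (I J : List (FrameIdx n)) (φ : Space n → ℝ) :
    horDeriv (I ++ J) φ = horDeriv I (horDeriv J φ) := by
  induction I with
  | nil => rfl
  | cons i I ih => simp only [List.cons_append, horDeriv, ih]

lemma horDeriv_singleton (i : FrameIdx n) (φ : Space n → ℝ) (x : Space n) :
    horDeriv [i] φ x = fderiv ℝ φ x (frame i x) := rfl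

lemma horDeriv_eqOn {W : Set (Space n)} (hW : IsOpen W) (I : List (FrameIdx n))
    {φ ψ : Space n → ℝ} (h : EqOn φ ψ W) : EqOn (horDeriv I φ) (horDeriv I ψ) W := by
  induction I with
  | nil => exact h
  | cons i I ih =>
    intro x hx
    have : horDeriv I φ =ᶠ[nhds x] horDeriv I ψ := ih.eventuallyEq_of_mem (hW.mem_nhds hx)
    simp only [horDeriv, this.fderiv_eq]

lemma frame_contDiff (i : FrameIdx n) : ContDiff ℝ ∞ (frame (n := n) i) := by
  cases i with
  | inl j =>
    have : ContDiff ℝ ∞ (fun x : Space n => x (idxY j)) :=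
      (EuclideanSpace.proj (𝕜 := ℝ) (idxY j)).contDiff
    exact contDiff_const.add (this.smul contDiff_const)
  | inr j => exact contDiff_const

lemma differentiable_horDeriv (I : List (FrameIdx n)) {φ : Space n → ℝ}
    (hφ : ContDiff ℝ ∞ φ) : Differentiable ℝ (horDeriv I φ) :=
  (horDeriv_contDiff I hφ).differentiable (by simp)

lemma continuous_horDeriv (I : List (FrameIdx n)) {φ : Space n → ℝ}
    (hφ : ContDiff ℝ ∞ φ) : Continuous (horDeriv I φ) :=
  (horDeriv_contDiff I hφ).continuous

/-- The Leibniz rule for iterated horizontal derivatives of a product. -/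
lemma exists_horDeriv_prod (p : ℕ) (I : List (FrameIdx n)) :
    ∃ (ι : Type) (_ : Fintype ι) (J : ι → Fin p → List (FrameIdx n)),
      (∀ e, ∑ j, (J e j).length = I.length) ∧
      ∀ f : Fin p → Space n → ℝ, (∀ j, ContDiff ℝ ∞ (f j)) →
        horDeriv I (fun x => ∏ j, f j x) = fun x => ∑ e, ∏ j, horDeriv (J e j) (f j) x := by
  induction I with
  | nil => exact ⟨Unit, inferInstance, fun _ _ => [], by simp, fun f _ => by simp [horDeriv]⟩
  | cons i I ih =>
    obtain ⟨ι, _, J, hJ, h⟩ := ih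
    -- The pair `(e, k)` stands for the term in which the new derivative falls on the factor `k` of
    -- the old term `e`.
    refine ⟨ι × Fin p, inferInstance,
      fun e => Function.update (J e.1) e.2 (i :: J e.1 e.2), ?_, ?_⟩
    · rintro ⟨e, k⟩
      have h1 := hJ e
      rw [← Finset.add_sum_erase _ _ (Finset.mem_univ k)] at h1 ⊢
      rw [Finset.sum_congr rfl (g := fun j => (J e j).length)]
      · simp only [Function.update_self, List.length_cons]
        omega
      · intro j hj
        simp only
        rw [Function.update_of_ne (Finset.ne_of_mem_erase hj)]
    · intro f hf
      funext x
      change fderiv ℝ (horDeriv I fun x => ∏ j, f j x) x (frame i x) = _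
      rw [h f hf, Fintype.sum_prod_type]
      have hd : ∀ e, HasFDerivAt (fun x => ∏ j, horDeriv (J e j) (f j) x)
          (∑ k, (∏ j ∈ Finset.univ.erase k, horDeriv (J e j) (f j) x) •
            fderiv ℝ (horDeriv (J e k) (f k)) x) x := fun e =>
        HasFDerivAt.finsetProd fun k _ =>
          (differentiable_horDeriv (J e k) (hf k) x).hasFDerivAt
      rw [(HasFDerivAt.fun_sum fun e _ => hd e).fderiv, sum_apply]
      refine Finset.sum_congr rfl fun e _ => ?_
      rw [sum_apply]
      refine Finset.sum_congr rfl fun k _ => ?_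
      rw [← Finset.prod_erase_mul _ _ (Finset.mem_univ k)]
      simp only [smul_apply, smul_eq_mul, Function.update_self]
      congr 1
      refine Finset.prod_congr rfl fun j hj => ?_
      rw [Function.update_of_ne (Finset.ne_of_mem_erase hj)]

lemma idxX_ne_idxT (j : Fin n) : (idxX j : Fin (2 * n + 1)) ≠ idxT n := by
  intro h
  have := congrArg Fin.val h
  simp [idxX, idxT] at this
  omega

lemma idxY_ne_idxT (j : Fin n) : (idxY j : Fin (2 * n + 1)) ≠ idxT n := by
  intro h
  have := congrArg Fin.val h
  simp [idxY, idxT] at this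
  omega

lemma idxX_ne_idxY (j k : Fin n) : (idxX j : Fin (2 * n + 1)) ≠ idxY k := by
  intro h
  have := congrArg Fin.val h
  simp [idxX, idxY] at this
  omega

lemma idxX_injective : Function.Injective (idxX (n := n)) := by
  intro j k h
  have := congrArg Fin.val h
  simp [idxX] at this
  omega

lemma idxY_injective : Function.Injective (idxY (n := n)) := by
  intro j k h
  have := congrArg Fin.val h
  simp [idxY] at this
  omega

lemma idx_cases (i : Fin (2 * n + 1)) :
    (∃ j : Fin n, i = idxX j) ∨ (∃ j : Fin n, i = idxY j) ∨ i = idxT n := by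
  rcases lt_or_ge i.1 n with h | h
  · exact Or.inl ⟨⟨i.1, h⟩, rfl⟩
  rcases lt_or_ge i.1 (2 * n) with h' | h'
  · exact Or.inr (Or.inl ⟨⟨i.1 - n, by omega⟩, Fin.ext (by simp [idxY]; omega)⟩)
  · exact Or.inr (Or.inr (Fin.ext (by simp [idxT]; omega)))

/-- The coordinate that is dual to a vector of the standard frame. -/
def frameCoord : FrameIdx n → Fin (2 * n + 1)
  | .inl j => idxX j
  | .inr j => idxY j

/-- The vector `∂/∂x^{2n+1}`. -/
def vertical (n : ℕ) : Space n := EuclideanSpace.single (idxT n) 1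

lemma stdForm_apply (z v : Space n) :
    stdForm z v = v (idxT n) - ∑ j : Fin n, z (idxY j) * v (idxX j) := by
  simp [stdForm]

/-- Every tangent vector is a combination of the standard frame and the vertical vector. -/
lemma frame_decomposition (z v : Space n) :
    v = ∑ k, v (frameCoord k) • frame k z + stdForm z v • vertical n := by
  rw [Fintype.sum_sum_type]
  ext i
  rcases idx_cases i with ⟨j, rfl⟩ | ⟨j, rfl⟩ | rfl
  · simp [frameCoord, frame, vertical, idxX_ne_idxT, idxX_ne_idxY, idxX_injective.eq_iff,
      Pi.single_apply]
  · simp [frameCoord, frame, vertical, idxY_ne_idxT, (idxX_ne_idxY _ _).symm,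
      idxY_injective.eq_iff, Pi.single_apply]
  · simp [frameCoord, frame, vertical, (idxX_ne_idxT _).symm, (idxY_ne_idxT _).symm,
      stdForm_apply, mul_comm]

lemma stdForm_frame (i : FrameIdx n) (z : Space n) : stdForm z (frame i z) = 0 := by
  rw [stdForm_apply]
  cases i with
  | inl j => simp [frame, idxX_ne_idxT, (idxX_ne_idxT _).symm, idxX_injective.eq_iff]
  | inr j => simp [frame, idxX_ne_idxY, (idxY_ne_idxT _).symm]

/-- The vertical derivative is the commutator of two horizontal ones. -/
lemma fderiv_vertical (j : Fin n) {φ : Space n → ℝ} (hφ : ContDiff ℝ ∞ φ) (z : Space n) :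
    fderiv ℝ φ z (vertical n) =
      horDeriv [.inr j, .inl j] φ z - horDeriv [.inl j, .inr j] φ z := by
  have hd : DifferentiableAt ℝ (fderiv ℝ φ) z :=
    (hφ.fderiv_right (m := ∞) (by simp)).differentiable (by simp) z
  have hfr : ∀ i : FrameIdx n, DifferentiableAt ℝ (frame (n := n) i) z := fun i =>
    (frame_contDiff i).differentiable (by simp) z
  have hsym : IsSymmSndFDerivAt ℝ φ z :=
    hφ.contDiffAt.isSymmSndFDerivAt (by
      simp only [minSmoothness_of_isRCLikeNormedField]
      exact WithTop.coe_le_coe.mpr le_top)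
  have key : ∀ i k : FrameIdx n, horDeriv [i, k] φ z =
      fderiv ℝ (fderiv ℝ φ) z (frame i z) (frame k z) +
        fderiv ℝ φ z (fderiv ℝ (frame k) z (frame i z)) := by
    intro i k
    change fderiv ℝ (fun x => fderiv ℝ φ x (frame k x)) z (frame i z) = _
    rw [(hd.hasFDerivAt.clm_apply (hfr k).hasFDerivAt).fderiv]
    simp [add_comm]
  have d1 : fderiv ℝ (frame (n := n) (.inr j)) z = 0 := by
    exact (hasFDerivAt_const (EuclideanSpace.single (idxY j) (1 : ℝ)) z).fderiv
  have d2 : fderiv ℝ (frame (n := n) (.inl j)) z (frame (.inr j) z) = vertical n := by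
    have : HasFDerivAt (frame (n := n) (.inl j))
        ((EuclideanSpace.proj (𝕜 := ℝ) (idxY j) : Space n →L[ℝ] ℝ).smulRight (vertical n)) z := by
      have h := (EuclideanSpace.proj (𝕜 := ℝ) (idxY j) : Space n →L[ℝ] ℝ).hasFDerivAt (x := z)
      exact (h.smul_const (vertical n)).const_add _
    rw [this.fderiv]
    simp [frame]
  -- The second-order terms cancel by symmetry. Since `X_{n+j}` is constant, only the derivative of
  -- the coefficient `x^{n+j}` of `X_j` survives.
  rw [key, key, d1, d2, hsym.eq (frame (.inr j) z)]
  simp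

/-! ### Change of variables for `L²` norms -/

/-- If the Jacobian of an injective map `τ` is bounded below on `L`, then `τ` pushes the Lebesgue
measure of `L` to at most a multiple of the Lebesgue measure of a set that contains `τ(L)`. -/
lemma map_restrict_le {L D : Set (Space n)} {τ : Space n → Space n}
    {τ' : Space n → Space n →L[ℝ] Space n} {c : ℝ} (hc : 0 < c) (hL : MeasurableSet L)
    (hD : MeasurableSet D)
    (hτ : ∀ x ∈ L, HasFDerivWithinAt τ (τ' x) L x) (hinj : InjOn τ L) (hmaps : MapsTo τ L D)
    (hdet : ∀ x ∈ L, c ≤ |(τ' x).det|) :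
    AEMeasurable τ (volume.restrict L) ∧
      (volume.restrict L).map τ ≤ (ENNReal.ofReal c)⁻¹ • volume.restrict D := by
  have hcont : ContinuousOn τ L := fun x hx => (hτ x hx).continuousWithinAt
  have hm : AEMeasurable τ (volume.restrict L) := hcont.aemeasurable hL
  refine ⟨hm, Measure.le_iff.mpr fun S hS => ?_⟩
  -- `τ` is only continuous on `L`, so measurability is obtained in the subtype.
  have hmeas : MeasurableSet (τ ⁻¹' S ∩ L) := by
    have h1 : Measurable (L.domRestrict τ) :=
      (continuousOn_iff_continuous_domRestrict.mp hcont).measurable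
    have h2 := hL.subtype_image (h1 hS)
    have e : Subtype.val '' (L.domRestrict τ ⁻¹' S) = τ ⁻¹' S ∩ L := by
      ext x
      simp [Set.domRestrict, and_comm]
    rwa [e] at h2
  rw [Measure.map_apply_of_aemeasurable hm hS, Measure.restrict_apply' hL, Measure.smul_apply,
    Measure.restrict_apply' hD, smul_eq_mul]
  have h3 := lintegral_abs_det_fderiv_eq_addHaar_image volume hmeas
    (fun x hx => (hτ x hx.2).mono inter_subset_right) (hinj.mono inter_subset_right)
  have h4 : ENNReal.ofReal c * volume (τ ⁻¹' S ∩ L) ≤ volume (S ∩ D) := by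
    calc ENNReal.ofReal c * volume (τ ⁻¹' S ∩ L)
        = ∫⁻ _ in τ ⁻¹' S ∩ L, ENNReal.ofReal c := by simp
      _ ≤ ∫⁻ x in τ ⁻¹' S ∩ L, ENNReal.ofReal |(τ' x).det| :=
          setLIntegral_mono' hmeas fun x hx => ENNReal.ofReal_le_ofReal (hdet x hx.2)
      _ = volume (τ '' (τ ⁻¹' S ∩ L)) := h3
      _ ≤ volume (S ∩ D) := measure_mono (by
          rintro _ ⟨x, hx, rfl⟩
          exact ⟨hx.1, hmaps hx.2⟩)
  rw [mul_comm (ENNReal.ofReal c)⁻¹, ← div_eq_mul_inv]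
  refine ENNReal.le_div_iff_mul_le (Or.inl (by simpa using hc)) (Or.inl (by simp)) |>.mpr ?_
  rwa [mul_comm]

/-- The `L²` norm of a function on a set. -/
def l2Norm (D : Set (Space n)) (g : Space n → ℝ) : ℝ := (eLpNorm g 2 (volume.restrict D)).toReal

lemma l2Norm_nonneg (D : Set (Space n)) (g : Space n → ℝ) : 0 ≤ l2Norm D g :=
  ENNReal.toReal_nonneg

/-- The constant is the square root of the inverse Jacobian bound `c`, because the exponent is `2`.
With `c = r^(2n+2)` this yields the power `r^(-(n+1))` in the Sobolev argument. -/
lemma memLp_comp_of_map_le {L D : Set (Space n)} {τ : Space n → Space n} {c : ℝ} (hc : 0 < c)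
    (hm : AEMeasurable τ (volume.restrict L))
    (hle : (volume.restrict L).map τ ≤ (ENNReal.ofReal c)⁻¹ • volume.restrict D)
    {g : Space n → ℝ} (hg : Continuous g) (hgD : MemLp g 2 (volume.restrict D)) :
    MemLp (g ∘ τ) 2 (volume.restrict L) ∧ l2Norm L (g ∘ τ) ≤ (√c)⁻¹ * l2Norm D g := by
  have e : eLpNorm (g ∘ τ) 2 (volume.restrict L) ≤
      (ENNReal.ofReal c)⁻¹ ^ (1 / (2 : ℝ)) * eLpNorm g 2 (volume.restrict D) := by
    rw [← eLpNorm_map_measure hg.aestronglyMeasurable hm]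
    refine (eLpNorm_mono_measure g hle).trans ?_
    rw [eLpNorm_smul_measure_of_ne_top (by simp)]
    simp
  have hfin : (ENNReal.ofReal c)⁻¹ ^ (1 / (2 : ℝ)) * eLpNorm g 2 (volume.restrict D) ≠ ⊤ := by
    refine ENNReal.mul_ne_top (ENNReal.rpow_ne_top_of_nonneg (by norm_num) ?_) hgD.2.ne
    simpa using hc
  refine ⟨⟨(hg.comp_aestronglyMeasurable hm.aestronglyMeasurable), e.trans_lt hfin.lt_top⟩, ?_⟩
  refine (ENNReal.toReal_mono hfin e).trans (le_of_eq ?_)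
  rw [ENNReal.toReal_mul, ← ENNReal.toReal_rpow, ENNReal.toReal_inv, ENNReal.toReal_ofReal hc.le,
    Real.inv_rpow hc.le, Real.sqrt_eq_rpow]
  rfl

/-- A function that is dominated by a linear combination of functions in `L²`. -/
lemma l2Norm_le_sum {ι : Type*} [Fintype ι] {D : Set (Space n)} (hD : MeasurableSet D)
    {g : Space n → ℝ} {h : ι → Space n → ℝ} {A : ι → ℝ} (hA : ∀ e, 0 ≤ A e)
    (hh : ∀ e, MemLp (h e) 2 (volume.restrict D))
    (hle : ∀ x ∈ D, |g x| ≤ ∑ e, A e * |h e x|) :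
    l2Norm D g ≤ ∑ e, A e * l2Norm D (h e) := by
  have h1 : eLpNorm g 2 (volume.restrict D) ≤
      ∑ e, eLpNorm (fun x => A e * ‖h e x‖) 2 (volume.restrict D) := by
    refine (eLpNorm_mono_ae_real (g := fun x => ∑ e, A e * |h e x|) ?_).trans ?_
    · exact (ae_restrict_iff' hD).mpr (Filter.Eventually.of_forall fun x hx => hle x hx)
    · have := eLpNorm_sum_le (s := Finset.univ) (f := fun e x => A e * ‖h e x‖) (p := 2)
        (fun e _ => ((hh e).norm.const_mul (A e)).1) (by norm_num)
      simp only [Finset.sum_fn] at this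
      exact this
  have h2 : ∀ e, eLpNorm (fun x => A e * ‖h e x‖) 2 (volume.restrict D) =
      ENNReal.ofReal (A e * l2Norm D (h e)) := by
    intro e
    rw [show (fun x => A e * ‖h e x‖) = A e • fun x => ‖h e x‖ from rfl, eLpNorm_const_smul,
      eLpNorm_norm, ENNReal.ofReal_mul (hA e), l2Norm, ENNReal.ofReal_toReal (hh e).2.ne,
      Real.enorm_eq_ofReal (hA e)]
  rw [Finset.sum_congr rfl fun e _ => h2 e,
    ← ENNReal.ofReal_sum_of_nonneg fun e _ => mul_nonneg (hA e) (l2Norm_nonneg _ _)] at h1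
  exact ENNReal.toReal_le_of_le_ofReal
    (Finset.sum_nonneg fun e _ => mul_nonneg (hA e) (l2Norm_nonneg _ _)) h1

/-- The Cauchy–Schwarz inequality. -/
lemma abs_integral_mul_le {D : Set (Space n)} {g h : Space n → ℝ}
    (hg : MemLp g 2 (volume.restrict D)) (hh : MemLp h 2 (volume.restrict D)) :
    |∫ x in D, g x * h x| ≤ l2Norm D g * l2Norm D h := by
  have h1 : |inner ℝ (hg.toLp g) (hh.toLp h)| ≤ _ := abs_real_inner_le_norm (hg.toLp g) (hh.toLp h)
  rw [L2.inner_def, Lp.norm_toLp, Lp.norm_toLp] at h1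
  refine (le_of_eq ?_).trans h1
  congr 1
  refine integral_congr_ae ?_
  filter_upwards [hg.coeFn_toLp, hh.coeFn_toLp] with x h2 h3
  rw [h2, h3]
  simp [mul_comm]

lemma memLp_of_continuous {D : Set (Space n)} (hD : Bornology.IsBounded D) {g : Space n → ℝ}
    (hg : Continuous g) : MemLp g 2 (volume.restrict D) := by
  have hK : IsCompact (closure D) := hD.isCompact_closure
  have : IsFiniteMeasure (volume.restrict (closure D)) := ⟨by simpa using hK.measure_lt_top⟩
  obtain ⟨C, hC⟩ := hK.exists_bound_of_continuousOn hg.continuousOn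
  refine MemLp.mono_measure (Measure.restrict_mono subset_closure le_rfl) ?_
  exact MemLp.of_bound hg.aestronglyMeasurable C
    ((ae_restrict_iff' isClosed_closure.measurableSet).mpr (Filter.Eventually.of_forall hC))

lemma l2Norm_mono {D D' : Set (Space n)} (h : D' ⊆ D) {g : Space n → ℝ}
    (hg : MemLp g 2 (volume.restrict D)) : l2Norm D' g ≤ l2Norm D g :=
  ENNReal.toReal_mono hg.2.ne (eLpNorm_mono_measure g (Measure.restrict_mono h le_rfl))

/-! ### Averages over dilated and translated balls -/

/-- The group dilation by `r` followed by the left translation by `p`, for the group structure on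
`ℝ^{2n+1}` that leaves the standard frame invariant. -/
def dilate (p : Space n) (r : ℝ) (q : Space n) : Space n :=
  p + r • q + ((r ^ 2 - r) * q (idxT n) + r * ∑ j : Fin n, p (idxY j) * q (idxX j)) • vertical n

/-- The linear part of `dilate p r`. -/
def dilateLin (p : Space n) (r : ℝ) : Space n →L[ℝ] Space n :=
  r • ContinuousLinearMap.id ℝ (Space n) +
    ((r ^ 2 - r) • (EuclideanSpace.proj (𝕜 := ℝ) (idxT n) : Space n →L[ℝ] ℝ) +
      r • ∑ j : Fin n, p (idxY j) •
        (EuclideanSpace.proj (𝕜 := ℝ) (idxX j) : Space n →L[ℝ] ℝ)).smulRight (vertical n)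

lemma dilateLin_apply (p : Space n) (r : ℝ) (v : Space n) : dilateLin p r v =
    r • v + ((r ^ 2 - r) * v (idxT n) + r * ∑ j : Fin n, p (idxY j) * v (idxX j)) •
      vertical n := by
  simp [dilateLin]

lemma dilate_eq (p : Space n) (r : ℝ) : dilate p r = fun q => p + dilateLin p r q := by
  funext q
  rw [dilateLin_apply, dilate, add_assoc]

lemma dilate_zero (p q : Space n) : dilate p 0 q = p := by simp [dilate]

lemma dilate_hasFDerivAt (p : Space n) (r : ℝ) (q : Space n) :
    HasFDerivAt (dilate p r) (dilateLin p r) q := by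
  rw [dilate_eq]
  exact (dilateLin p r).hasFDerivAt.const_add p

lemma dilate_contDiff (p : Space n) (r : ℝ) : ContDiff ℝ ∞ (dilate p r) := by
  rw [dilate_eq]
  exact contDiff_const.add (dilateLin p r).contDiff

lemma continuous_coord (i : Fin (2 * n + 1)) : Continuous fun x : Space n => x i :=
  (EuclideanSpace.proj (𝕜 := ℝ) i).continuous

lemma continuous_dilate : Continuous fun z : Space n × ℝ × Space n => dilate z.1 z.2.1 z.2.2 := by
  have h1 : ∀ i, Continuous fun z : Space n × ℝ × Space n => z.1 i := fun i =>
    (continuous_coord i).comp continuous_fst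
  have h2 : ∀ i, Continuous fun z : Space n × ℝ × Space n => z.2.2 i := fun i =>
    (continuous_coord i).comp (continuous_snd.comp continuous_snd)
  unfold dilate
  fun_prop

/-- The velocity of `r ↦ dilate p r q`. -/
def dilateVel (p : Space n) (r : ℝ) (q : Space n) : Space n :=
  q + ((2 * r - 1) * q (idxT n) + ∑ j : Fin n, p (idxY j) * q (idxX j)) • vertical n

lemma dilate_hasDerivAt (p q : Space n) (r : ℝ) :
    HasDerivAt (fun r => dilate p r q) (dilateVel p r q) r := by
  have h0 := hasDerivAt_id r
  have h1 : HasDerivAt (fun r : ℝ => r • q) q r := by simpa using h0.smul_const q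
  have h2 : HasDerivAt (fun r : ℝ => (r ^ 2 - r) * q (idxT n) +
      r * ∑ j : Fin n, p (idxY j) * q (idxX j))
      ((2 * r - 1) * q (idxT n) + ∑ j : Fin n, p (idxY j) * q (idxX j)) r := by
    have := (((h0.pow 2).sub h0).mul_const (q (idxT n))).add
      (h0.mul_const (∑ j : Fin n, p (idxY j) * q (idxX j)))
    refine (this.congr_deriv ?_)
    simp
  exact (h1.const_add p).add (h2.smul_const (vertical n))

lemma vertical_X (j : Fin n) : vertical n (idxX j) = 0 := by
  simp [vertical, idxX_ne_idxT]

lemma vertical_Y (j : Fin n) : vertical n (idxY j) = 0 := by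
  simp [vertical, idxY_ne_idxT]

lemma vertical_T : vertical n (idxT n) = 1 := by
  simp [vertical]

lemma vertical_frameCoord (i : FrameIdx n) : vertical n (frameCoord i) = 0 := by
  cases i
  exacts [vertical_X _, vertical_Y _]

lemma dilate_Y (p : Space n) (r : ℝ) (q : Space n) (j : Fin n) :
    dilate p r q (idxY j) = p (idxY j) + r * q (idxY j) := by
  simp [dilate, vertical_Y]

/-- The frame is invariant under left translations and homogeneous of degree one under dilations.
This is what trades a factor `r` for a derivative in the variable `q`. -/
lemma dilateLin_frame (p : Space n) (r : ℝ) (q : Space n) (i : FrameIdx n) :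
    dilateLin p r (frame i q) = r • frame i (dilate p r q) := by
  rw [dilateLin_apply]
  cases i with
  | inl j =>
    have e1 : frame (.inl j) q (idxT n) = q (idxY j) := by
      simp [frame, (idxX_ne_idxT _).symm]
    have e2 : ∀ k, frame (.inl j) q (idxX k) = if k = j then 1 else 0 := by
      intro k
      simp [frame, idxX_ne_idxT, idxX_injective.eq_iff]
    have e3 : ∀ z : Space n, frame (.inl j) z =
        EuclideanSpace.single (idxX j) 1 + z (idxY j) • vertical n := fun z => rfl
    have e4 : ∑ k, p (idxY k) * frame (.inl j) q (idxX k) = p (idxY j) := by simp [e2]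
    rw [e1, e4, e3, e3, dilate_Y]
    module
  | inr j =>
    simp [frame, (idxY_ne_idxT _).symm, idxX_ne_idxY]

/-- The decisive point is the factor `r` in the vertical component, obtained by evaluating `η₀` on
the velocity: it pays for one of the two horizontal derivatives that make up the vertical one. -/
lemma dilateVel_eq (p : Space n) (r : ℝ) (q : Space n) :
    dilateVel p r q = ∑ k, q (frameCoord k) • frame k (dilate p r q) +
      (r * (2 * q (idxT n) - ∑ j : Fin n, q (idxY j) * q (idxX j))) • vertical n := by
  have h := frame_decomposition (dilate p r q) (dilateVel p r q)
  have e1 : ∀ k, dilateVel p r q (frameCoord k) = q (frameCoord k) := fun k => by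
    simp [dilateVel, vertical_frameCoord]
  have e2 : stdForm (dilate p r q) (dilateVel p r q) =
      r * (2 * q (idxT n) - ∑ j : Fin n, q (idxY j) * q (idxX j)) := by
    rw [stdForm_apply]
    have e3 : ∀ j, dilateVel p r q (idxX j) = q (idxX j) := fun j => e1 (.inl j)
    simp only [e3, dilate_Y]
    simp only [dilateVel, PiLp.add_apply, PiLp.smul_apply, vertical_T, add_mul,
      Finset.sum_add_distrib, mul_assoc, ← Finset.mul_sum, smul_eq_mul]
    ring
  rw [e2] at h
  simpa only [e1] using h

/-- The map is `r` times a transvection along the vertical vector, whose functional takes the value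
`r - 1` there. The determinant is therefore `r^(2n+1) * (1 + (r - 1))`. -/
lemma det_dilateLin (p : Space n) (r : ℝ) :
    (dilateLin p r).det = r ^ (2 * n + 2) := by
  let f : Space n →L[ℝ] ℝ := (r - 1) • EuclideanSpace.proj (𝕜 := ℝ) (idxT n) +
      ∑ j : Fin n, p (idxY j) • EuclideanSpace.proj (𝕜 := ℝ) (idxX j)
  have hf : ∀ v, f v = (r - 1) * v (idxT n) + ∑ j : Fin n, p (idxY j) * v (idxX j) := fun v => by
    simp [f]
  have e : (dilateLin p r : Space n →ₗ[ℝ] Space n) =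
      r • LinearMap.transvection (f : Space n →ₗ[ℝ] ℝ) (vertical n) := by
    refine LinearMap.ext fun v => ?_
    simp only [LinearMap.smul_apply, LinearMap.transvection.apply, ContinuousLinearMap.coe_coe,
      dilateLin_apply, hf]
    module
  rw [ContinuousLinearMap.det, e, LinearMap.det_smul, LinearMap.transvection.det,
    ContinuousLinearMap.coe_coe, hf, finrank_euclideanSpace_fin]
  simp only [vertical_X, vertical_T, mul_zero, Finset.sum_const_zero]
  ring

lemma horDeriv_comp_dilate (p : Space n) (r : ℝ) (i : FrameIdx n) {h : Space n → ℝ}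
    (hh : ContDiff ℝ ∞ h) (q : Space n) :
    horDeriv [i] (fun q => h (dilate p r q)) q = r * horDeriv [i] h (dilate p r q) := by
  simp only [horDeriv]
  have h1 : HasFDerivAt h (fderiv ℝ h (dilate p r q)) (dilate p r q) :=
    (hh.differentiable (by simp) _).hasFDerivAt
  have := (h1.comp q (dilate_hasFDerivAt p r q)).fderiv
  simp only [Function.comp_def] at this
  rw [this, ContinuousLinearMap.comp_apply, dilateLin_frame, map_smul, smul_eq_mul]

/-- Test functions on the unit ball. -/
structure IsTest (ψ : Space n → ℝ) : Prop where
  smooth : ContDiff ℝ ∞ ψ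
  compact : HasCompactSupport ψ
  subset : tsupport ψ ⊆ Metric.ball 0 1

lemma IsTest.mul_left {ψ χ : Space n → ℝ} (h : IsTest ψ) (hχ : ContDiff ℝ ∞ χ) :
    IsTest fun q => χ q * ψ q where
  smooth := hχ.mul h.smooth
  compact := h.compact.mul_left
  subset := (closure_mono (Function.support_mul_subset_right χ ψ)).trans h.subset

lemma IsTest.neg {ψ : Space n → ℝ} (h : IsTest ψ) : IsTest fun q => -ψ q := by
  simpa using h.mul_left (contDiff_const (c := (-1 : ℝ)))

lemma integrable_average {ψ : Space n → ℝ} (hψ : IsTest ψ) {g : Space n → ℝ}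
    (hg : Continuous g) : Integrable fun q => g q * ψ q :=
  (hg.mul hψ.smooth.continuous).integrable_of_hasCompactSupport hψ.compact.mul_left

lemma continuous_dilateVel :
    Continuous fun z : Space n × ℝ × Space n => dilateVel z.1 z.2.1 z.2.2 := by
  have h1 : ∀ i, Continuous fun z : Space n × ℝ × Space n => z.1 i := fun i =>
    (continuous_coord i).comp continuous_fst
  have h2 : ∀ i, Continuous fun z : Space n × ℝ × Space n => z.2.2 i := fun i =>
    (continuous_coord i).comp (continuous_snd.comp continuous_snd)
  unfold dilateVel
  fun_prop

lemma hasDerivAt_average {ψ h : Space n → ℝ} (hψ : IsTest ψ) (hh : ContDiff ℝ ∞ h)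
    (p : Space n) (r : ℝ) :
    HasDerivAt (fun r => ∫ q, h (dilate p r q) * ψ q)
      (∫ q, fderiv ℝ h (dilate p r q) (dilateVel p r q) * ψ q) r := by
  have c1 : Continuous fun z : ℝ × Space n => dilate p z.1 z.2 :=
    continuous_dilate.comp (continuous_const.prodMk continuous_id)
  have c2 : Continuous fun z : ℝ × Space n => dilateVel p z.1 z.2 :=
    continuous_dilateVel.comp (continuous_const.prodMk continuous_id)
  have c3 : Continuous fun z : ℝ × Space n =>
      fderiv ℝ h (dilate p z.1 z.2) (dilateVel p z.1 z.2) :=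
    ((hh.continuous_fderiv (by simp)).comp c1).clm_apply c2
  have cr : ∀ r : ℝ, Continuous fun q : Space n => (r, q) := fun r =>
    continuous_const.prodMk continuous_id
  -- A uniform bound for scales within distance `1` of `r` and `q` in the support of `ψ` gives the
  -- dominating function `C * ‖ψ‖`.
  obtain ⟨C, hC⟩ := ((isCompact_closedBall r 1).prod hψ.compact).exists_bound_of_continuousOn
    c3.continuousOn
  refine (hasDerivAt_integral_of_dominated_loc_of_deriv_le
    (F := fun r q => h (dilate p r q) * ψ q)
    (F' := fun r q => fderiv ℝ h (dilate p r q) (dilateVel p r q) * ψ q)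
    (bound := fun q => C * ‖ψ q‖)
    (Metric.closedBall_mem_nhds r one_pos) ?_ ?_ ?_ ?_ ?_ ?_).2
  · exact Filter.Eventually.of_forall fun r =>
      ((hh.continuous.comp (c1.comp (cr r))).mul hψ.smooth.continuous).aestronglyMeasurable
  · exact integrable_average hψ (hh.continuous.comp (c1.comp (cr r)))
  · exact ((c3.comp (cr r)).mul hψ.smooth.continuous).aestronglyMeasurable
  · refine Filter.Eventually.of_forall fun q t ht => ?_
    by_cases hq : q ∈ tsupport ψ
    · rw [norm_mul]
      exact mul_le_mul_of_nonneg_right (hC (t, q) ⟨ht, hq⟩) (norm_nonneg _)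
    · simp [image_eq_zero_of_notMem_tsupport hq]
  · exact ((hψ.smooth.continuous.integrable_of_hasCompactSupport hψ.compact).norm).const_mul C
  · refine Filter.Eventually.of_forall fun q t _ => ?_
    have h1 : HasFDerivAt h (fderiv ℝ h (dilate p t q)) (dilate p t q) :=
      (hh.differentiable (by simp) _).hasFDerivAt
    exact (h1.comp_hasDerivAt t (dilate_hasDerivAt p q t)).mul_const (ψ q)

/-- Differentiating an average with respect to the scale produces averages of horizontal
derivatives. -/
lemma exists_deriv_average (j : Fin n) {ψ : Space n → ℝ} (hψ : IsTest ψ) :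
    ∃ (i : FrameIdx n ⊕ Bool → FrameIdx n) (ψ' : FrameIdx n ⊕ Bool → Space n → ℝ),
      (∀ e, IsTest (ψ' e)) ∧ ∀ h : Space n → ℝ, ContDiff ℝ ∞ h → ∀ p r,
        HasDerivAt (fun r => ∫ q, h (dilate p r q) * ψ q)
          (∑ e, ∫ q, horDeriv [i e] h (dilate p r q) * ψ' e q) r := by
  have hcoord : ∀ i, ContDiff ℝ ∞ fun x : Space n => x i := fun i =>
    (EuclideanSpace.proj (𝕜 := ℝ) i).contDiff
  set χ : Space n → ℝ := fun q => 2 * q (idxT n) - ∑ j : Fin n, q (idxY j) * q (idxX j) with hχ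
  have hχs : ContDiff ℝ ∞ χ := (contDiff_const.mul (hcoord _)).sub
    (ContDiff.sum fun j _ => (hcoord _).mul (hcoord _))
  have hχψ := hψ.mul_left hχs
  obtain ⟨ψY, hY1, hY2, hY3, hY⟩ := exists_adjoint (Metric.ball 0 1) [.inr j] _ hχψ.smooth
    hχψ.compact hχψ.subset
  obtain ⟨ψX, hX1, hX2, hX3, hX⟩ := exists_adjoint (Metric.ball 0 1) [.inl j] _ hχψ.smooth
    hχψ.compact hχψ.subset
  -- The left summands come from the horizontal part of the velocity. The two right ones come from
  -- the commutator, after the outer field has been moved onto the test function; `true` is the term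
  -- with `X_j` left on `h`, `false` the one with `X_{n+j}`.
  refine ⟨Sum.elim id fun b => cond b (.inl j) (.inr j),
    Sum.elim (fun k q => q (frameCoord k) * ψ q) fun b => cond b ψY fun q => -ψX q, ?_, ?_⟩
  · rintro (k | _ | _)
    · exact hψ.mul_left (hcoord _)
    · exact IsTest.neg ⟨hX1, hX2, hX3⟩
    · exact ⟨hY1, hY2, hY3⟩
  · intro h hh p r
    refine (hasDerivAt_average hψ hh p r).congr_deriv ?_
    have hc : ∀ I, Continuous fun q => horDeriv I h (dilate p r q) := fun I =>
      (continuous_horDeriv I hh).comp (dilate_contDiff p r).continuous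
    have hs : ∀ I, ContDiff ℝ ∞ fun q => horDeriv I h (dilate p r q) := fun I =>
      (horDeriv_contDiff I hh).comp (dilate_contDiff p r)
    -- The factor `r` of the vertical component is absorbed by the outer field of each commutator
    -- term, which becomes a derivative of a composition with `dilate p r` and can be integrated by
    -- parts in `q`.
    have e1 : ∀ q, fderiv ℝ h (dilate p r q) (dilateVel p r q) * ψ q =
        ∑ k, horDeriv [k] h (dilate p r q) * (q (frameCoord k) * ψ q) +
          (horDeriv [.inr j] (fun q => horDeriv [.inl j] h (dilate p r q)) q * (χ q * ψ q) -
          horDeriv [.inl j] (fun q => horDeriv [.inr j] h (dilate p r q)) q * (χ q * ψ q)) := by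
      intro q
      rw [horDeriv_comp_dilate _ _ _ (horDeriv_contDiff _ hh),
        horDeriv_comp_dilate _ _ _ (horDeriv_contDiff _ hh), ← horDeriv_append,
        ← horDeriv_append, dilateVel_eq, map_add, map_sum, map_smul, fderiv_vertical j hh,
        add_mul, Finset.sum_mul]
      congr 1
      · refine Finset.sum_congr rfl fun k _ => ?_
        rw [map_smul, horDeriv_singleton, smul_eq_mul]
        ring
      · simp only [hχ, smul_eq_mul, List.cons_append, List.nil_append]
        ring
    simp only [e1]
    have i1 : ∀ k, Integrable fun q =>
        horDeriv [k] h (dilate p r q) * (q (frameCoord k) * ψ q) := fun k =>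
      integrable_average (hψ.mul_left (hcoord _)) (hc [k])
    have i2 : ∀ k l, Integrable fun q =>
        horDeriv [k] (fun q => horDeriv [l] h (dilate p r q)) q * (χ q * ψ q) := fun k l =>
      integrable_average hχψ (continuous_horDeriv _ (hs _))
    have i3 : Integrable fun q =>
        horDeriv [.inr j] (fun q => horDeriv [.inl j] h (dilate p r q)) q * (χ q * ψ q) -
          horDeriv [.inl j] (fun q => horDeriv [.inr j] h (dilate p r q)) q * (χ q * ψ q) :=
      (i2 _ _).sub (i2 _ _)
    rw [integral_add (integrable_finsetSum _ fun k _ => i1 k) i3,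
      integral_finsetSum _ fun k _ => i1 k, integral_sub (i2 _ _) (i2 _ _),
      hY _ (hs _), hX _ (hs _), Fintype.sum_sum_type]
    simp [integral_neg, sub_eq_add_neg]

/-- Finite sums of averages of horizontal derivatives of order `k`. -/
def IsAverage (k : ℕ) (G : (Space n → ℝ) → Space n → ℝ → ℝ) : Prop :=
  ∃ (κ : Type) (_ : Fintype κ) (J : κ → List (FrameIdx n)) (ψ : κ → Space n → ℝ),
    (∀ e, (J e).length = k) ∧ (∀ e, IsTest (ψ e)) ∧
    ∀ h, ContDiff ℝ ∞ h → ∀ p r, G h p r = ∑ e, ∫ q, horDeriv (J e) h (dilate p r q) * ψ e q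

/-- The class of averages is stable under differentiation in the scale, at the price of one
horizontal derivative and no power of `r`. This permits iteration up to order `n + 2`. -/
lemma IsAverage.exists_deriv (j : Fin n) {k : ℕ} {G : (Space n → ℝ) → Space n → ℝ → ℝ}
    (hG : IsAverage k G) : ∃ G' : (Space n → ℝ) → Space n → ℝ → ℝ, IsAverage (k + 1) G' ∧
      ∀ h, ContDiff ℝ ∞ h → ∀ p r, HasDerivAt (G h p) (G' h p r) r := by
  obtain ⟨κ, _, J, ψ, hJ, hψ, h1⟩ := hG
  choose i ψ' h2 h3 using fun e => exists_deriv_average j (hψ e)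
  refine ⟨fun h p r => ∑ e : κ × (FrameIdx n ⊕ Bool),
    ∫ q, horDeriv (i e.1 e.2 :: J e.1) h (dilate p r q) * ψ' e.1 e.2 q,
    ⟨κ × (FrameIdx n ⊕ Bool), inferInstance, _, fun e => ψ' e.1 e.2, fun e => ?_,
      fun e => h2 e.1 e.2, fun h _ p r => rfl⟩, fun h hh p r => ?_⟩
  · simp [hJ]
  · rw [funext (h1 h hh p)]
    simp only [Fintype.sum_prod_type]
    exact HasDerivAt.fun_sum fun e _ => h3 e _ (horDeriv_contDiff (J e) hh) p r

/-! ### The Sobolev inequality -/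

/-- The derivative of the Taylor polynomial at `0`, as a function of the base point. -/
lemma hasDerivAt_taylor_sum {G : ℕ → ℝ → ℝ} (hG : ∀ j r, HasDerivAt (G j) (G (j + 1) r) r)
    (m : ℕ) (r : ℝ) :
    HasDerivAt (fun r => ∑ j ∈ Finset.range (m + 1), (-r) ^ j / (j.factorial : ℝ) * G j r)
      ((-r) ^ m / (m.factorial : ℝ) * G (m + 1) r) r := by
  induction m with
  | zero => simpa using hG 0 r
  | succ m ih =>
    simp only [Finset.sum_range_succ _ (m + 1)]
    have h1 : HasDerivAt (fun r : ℝ => (-r) ^ (m + 1) / ((m + 1).factorial : ℝ))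
        (-((-r) ^ m / (m.factorial : ℝ))) r := by
      have h2 : HasDerivAt (fun r : ℝ => (-r) ^ (m + 1)) (-((m + 1 : ℝ) * (-r) ^ m)) r := by
        have := ((hasDerivAt_id r).neg.pow (m + 1))
        refine this.congr_deriv ?_
        simp
      refine (h2.div_const _).congr_deriv ?_
      have : ((m + 1).factorial : ℝ) = (m + 1) * m.factorial := by
        rw [Nat.factorial_succ]; push_cast; ring
      have h3 : (m.factorial : ℝ) ≠ 0 := by exact_mod_cast m.factorial_ne_zero
      have h4 : (m + 1 : ℝ) ≠ 0 := by positivity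
      rw [this]
      field_simp
    refine (ih.add (h1.mul (hG (m + 1) r))).congr_deriv ?_
    ring

/-- The sum of the `L²` norms of the horizontal derivatives of order at most `m`. -/
def derivNorm (D : Set (Space n)) (m : ℕ) (h : Space n → ℝ) : ℝ :=
  ∑ I : MultiIdx n m, l2Norm D (horDeriv I.1 h)

lemma derivNorm_nonneg (D : Set (Space n)) (m : ℕ) (h : Space n → ℝ) : 0 ≤ derivNorm D m h :=
  Finset.sum_nonneg fun _ _ => l2Norm_nonneg _ _

lemma l2Norm_le_derivNorm (D : Set (Space n)) {m : ℕ} (h : Space n → ℝ) (I : MultiIdx n m) :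
    l2Norm D (horDeriv I.1 h) ≤ derivNorm D m h := by
  have h0 : ∀ I ∈ (Finset.univ : Finset (MultiIdx n m)), 0 ≤ l2Norm D (horDeriv I.1 h) :=
    fun _ _ => l2Norm_nonneg _ _
  exact Finset.single_le_sum h0 (Finset.mem_univ I)

/-- Cauchy–Schwarz on the unit ball separates the test function from `X_J h` composed with the
dilation. Undoing the dilation costs the inverse square root of its Jacobian `r^(2n+2)`. -/
lemma IsAverage.bound {D : Set (Space n)} (hD : IsOpen D) (hDb : Bornology.IsBounded D)
    {k m : ℕ} (hk : k ≤ m) {G : (Space n → ℝ) → Space n → ℝ → ℝ} (hG : IsAverage k G) :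
    ∃ C : ℝ, 0 ≤ C ∧ ∀ h, ContDiff ℝ ∞ h → ∀ p r, 0 < r →
      MapsTo (dilate p r) (Metric.ball 0 1) D →
        |G h p r| ≤ C * (r ^ (n + 1))⁻¹ * derivNorm D m h := by
  obtain ⟨κ, _, J, ψ, hJ, hψ, h1⟩ := hG
  refine ⟨∑ e, l2Norm (Metric.ball 0 1) (ψ e), Finset.sum_nonneg fun _ _ => l2Norm_nonneg _ _,
    fun h hh p r hr hmaps => ?_⟩
  rw [h1 h hh p r, Finset.sum_mul, Finset.sum_mul]
  refine (Finset.abs_sum_le_sum_abs _ _).trans (Finset.sum_le_sum fun e _ => ?_)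
  have hdet : ∀ x ∈ Metric.ball (0 : Space n) 1,
      r ^ (2 * n + 2) ≤ |(dilateLin p r).det| := fun x _ => by
    rw [det_dilateLin]
    exact le_abs_self _
  have hinj : Function.Injective (dilate p r) := by
    have hdet : LinearMap.det (dilateLin p r : Space n →ₗ[ℝ] Space n) ≠ 0 := by
      have := det_dilateLin p r
      rw [ContinuousLinearMap.det] at this
      rw [this]
      positivity
    have := (LinearMap.equivOfDetNeZero _ hdet).injective
    rw [dilate_eq]
    intro x y hxy
    exact this (add_left_cancel hxy)
  obtain ⟨hm, hle⟩ := map_restrict_le (τ := dilate p r) (τ' := fun _ => dilateLin p r)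
    (pow_pos hr (2 * n + 2)) measurableSet_ball hD.measurableSet
    (fun x _ => (dilate_hasFDerivAt p r x).hasFDerivWithinAt) hinj.injOn hmaps hdet
  have hc := continuous_horDeriv (J e) hh
  obtain ⟨hL, hN⟩ := memLp_comp_of_map_le (pow_pos hr (2 * n + 2)) hm hle hc
    (memLp_of_continuous hDb hc)
  have hsq : √(r ^ (2 * n + 2)) = r ^ (n + 1) := by
    rw [show 2 * n + 2 = (n + 1) * 2 by ring, pow_mul, Real.sqrt_sq (by positivity)]
  rw [hsq] at hN
  have e1 : ∫ q, horDeriv (J e) h (dilate p r q) * ψ e q =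
      ∫ q in Metric.ball 0 1, horDeriv (J e) h (dilate p r q) * ψ e q :=
    (setIntegral_eq_integral_of_forall_compl_eq_zero fun x hx => by
      rw [image_eq_zero_of_notMem_tsupport (fun hx' => hx ((hψ e).subset hx')), mul_zero]).symm
  rw [e1]
  have h2 := abs_integral_mul_le hL
    (memLp_of_continuous Metric.isBounded_ball (hψ e).smooth.continuous)
  refine h2.trans ?_
  have h3 : l2Norm (Metric.ball 0 1) (horDeriv (J e) h ∘ dilate p r) ≤
      (r ^ (n + 1))⁻¹ * derivNorm D m h :=
    hN.trans (mul_le_mul_of_nonneg_left (l2Norm_le_derivNorm D h ⟨J e, (hJ e).le.trans hk⟩)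
      (by positivity))
  calc _ ≤ ((r ^ (n + 1))⁻¹ * derivNorm D m h) * l2Norm (Metric.ball 0 1) (ψ e) :=
        mul_le_mul_of_nonneg_right h3 (l2Norm_nonneg _ _)
    _ = _ := by ring

/-- At `r = 0` the dilation is constantly `p`, which lies in `D`. The tube lemma over `K` times the
closed unit ball makes the admissible scale uniform in `p`. -/
lemma exists_dilate_mapsTo {K D : Set (Space n)} (hK : IsCompact K) (hD : IsOpen D)
    (hKD : K ⊆ D) : ∃ r₀ : ℝ, 0 < r₀ ∧ ∀ p ∈ K, ∀ r, 0 ≤ r → r ≤ r₀ →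
      MapsTo (dilate p r) (Metric.ball 0 1) D := by
  have ho : IsOpen {z : ℝ × Space n × Space n | dilate z.2.1 z.1 z.2.2 ∈ D} :=
    hD.preimage (continuous_dilate.comp (continuous_fst.comp continuous_snd |>.prodMk
      (continuous_fst.prodMk (continuous_snd.comp continuous_snd))))
  obtain ⟨U, V, hU, -, h0, hV, hUV⟩ := generalized_tube_lemma (s := {(0 : ℝ)})
    (t := K ×ˢ Metric.closedBall (0 : Space n) 1) isCompact_singleton
    (hK.prod (isCompact_closedBall _ _)) ho (by
      rintro ⟨r, p, q⟩ ⟨hr, hp, -⟩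
      obtain rfl : r = 0 := hr
      simpa [dilate_zero] using hKD hp)
  obtain ⟨ε, hε, hεU⟩ := Metric.isOpen_iff.mp hU 0 (h0 rfl)
  refine ⟨ε / 2, by positivity, fun p hp r hr hr' q hq => ?_⟩
  refine hUV (mk_mem_prod (a := r) (b := (p, q)) (hεU ?_)
    (hV (mk_mem_prod hp (Metric.ball_subset_closedBall hq))))
  rw [Metric.mem_ball, dist_zero_right, Real.norm_of_nonneg hr]
  linarith

lemma exists_isTest_integral_eq_one : ∃ ψ : Space n → ℝ, IsTest ψ ∧ ∫ q, ψ q = 1 := by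
  let f : ContDiffBump (0 : Space n) := ⟨1 / 4, 1 / 2, by norm_num, by norm_num⟩
  refine ⟨f.normed volume, ⟨f.contDiff_normed, f.hasCompactSupport_normed, ?_⟩,
    f.integral_normed⟩
  rw [f.tsupport_normed_eq]
  exact Metric.closedBall_subset_ball (by norm_num [f])

/-- The Sobolev inequality: `n + 2` horizontal derivatives in `L²` control the values. -/
theorem exists_sobolev (hn : 1 ≤ n) {K D : Set (Space n)} (hK : IsCompact K) (hD : IsOpen D)
    (hDb : Bornology.IsBounded D) (hKD : K ⊆ D) :
    ∃ C : ℝ, 0 ≤ C ∧ ∀ h, ContDiff ℝ ∞ h → ∀ p ∈ K, |h p| ≤ C * derivNorm D (n + 2) h := by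
  obtain ⟨r₀, hr₀, hmaps⟩ := exists_dilate_mapsTo hK hD hKD
  obtain ⟨ψ, hψ, hψ1⟩ := exists_isTest_integral_eq_one (n := n)
  -- The hypothesis `1 ≤ n` provides the pair of fields whose commutator is the vertical field.
  choose! next hnext hnext' using fun (k : ℕ) (G : (Space n → ℝ) → Space n → ℝ → ℝ)
    (hG : IsAverage k G) => hG.exists_deriv ⟨0, hn⟩
  let G₀ : (Space n → ℝ) → Space n → ℝ → ℝ := fun h p r => ∫ q, h (dilate p r q) * ψ q
  let G : ℕ → (Space n → ℝ) → Space n → ℝ → ℝ := fun k => Nat.rec G₀ next k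
  have hG : ∀ k, IsAverage k (G k) := by
    intro k
    induction k with
    | zero =>
      exact ⟨Unit, inferInstance, fun _ => [], fun _ => ψ, fun _ => rfl, fun _ => hψ,
        fun h _ p r => by simp [G, G₀, horDeriv]⟩
    | succ k ih => exact hnext k _ ih
  have hG' : ∀ k h, ContDiff ℝ ∞ h → ∀ p r, HasDerivAt (G k h p) (G (k + 1) h p r) r :=
    fun k h hh p r => hnext' k _ (hG k) h hh p r
  choose! C hC hb using fun (k : ℕ) (hk : k ≤ n + 2) => (hG k).bound hD hDb hk
  set A : ℝ := ∑ j ∈ Finset.range (n + 2), r₀ ^ j / (j.factorial : ℝ) *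
    (C j * (r₀ ^ (n + 1))⁻¹) with hA
  have hA0 : 0 ≤ A := Finset.sum_nonneg fun j hj =>
    mul_nonneg (by positivity) (mul_nonneg (hC j (Finset.mem_range.mp hj).le) (by positivity))
  refine ⟨A + C (n + 2) * r₀, add_nonneg hA0 (mul_nonneg (hC _ le_rfl) hr₀.le),
    fun h hh p hp => ?_⟩
  set N := derivNorm D (n + 2) h with hN
  have hN0 : 0 ≤ N := derivNorm_nonneg _ _ _
  -- `H r` is the Taylor polynomial of degree `n + 1` of the average, expanded at `r` and evaluated
  -- at `0`. Its value at `r = 0` is `h p`, and its derivative contains only the derivative of order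
  -- `n + 2`.
  set H : ℝ → ℝ := fun r => ∑ j ∈ Finset.range (n + 1 + 1),
    (-r) ^ j / (j.factorial : ℝ) * G j h p r with hH
  have hd : ∀ r, HasDerivAt H ((-r) ^ (n + 1) / ((n + 1).factorial : ℝ) * G (n + 2) h p r) r :=
    fun r => hasDerivAt_taylor_sum (G := fun j => G j h p) (fun j r => hG' j h hh p r) (n + 1) r
  have h0 : H 0 = h p := by
    simp only [hH, Finset.sum_range_succ' _ (n + 1)]
    simp [G, G₀, dilate_zero, integral_const_mul, hψ1]
  have hr : |H r₀| ≤ A * N := by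
    rw [hA, Finset.sum_mul]
    refine (Finset.abs_sum_le_sum_abs _ _).trans (Finset.sum_le_sum fun j hj => ?_)
    rw [abs_mul, abs_div, abs_pow, abs_neg, abs_of_pos hr₀, Nat.abs_cast, mul_assoc]
    exact mul_le_mul_of_nonneg_left (hb j (Finset.mem_range.mp hj).le h hh p r₀ hr₀
      (hmaps p hp r₀ hr₀.le le_rfl)) (by positivity)
  -- The factor `r^(n+1)` cancels the singularity `r^(-(n+1))` of the bound. At `r = 0`, where that
  -- bound is unavailable, the factor itself vanishes.
  have hderiv : ∀ r ∈ Ico (0 : ℝ) r₀,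
      ‖(-r) ^ (n + 1) / ((n + 1).factorial : ℝ) * G (n + 2) h p r‖ ≤ C (n + 2) * N := by
    rintro r ⟨hr1, hr2⟩
    rcases hr1.eq_or_lt with rfl | hr1
    · simpa using mul_nonneg (hC _ le_rfl) hN0
    · have h2 := hb (n + 2) le_rfl h hh p r hr1 (hmaps p hp r hr1.le hr2.le)
      have hf : (1 : ℝ) ≤ (n + 1).factorial := by exact_mod_cast (n + 1).factorial_pos
      rw [Real.norm_eq_abs, abs_mul, abs_div, abs_pow, abs_neg, abs_of_pos hr1, Nat.abs_cast]
      calc r ^ (n + 1) / ((n + 1).factorial : ℝ) * |G (n + 2) h p r|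
          ≤ r ^ (n + 1) * (C (n + 2) * (r ^ (n + 1))⁻¹ * N) :=
            mul_le_mul (div_le_self (by positivity) hf) h2 (abs_nonneg _) (by positivity)
        _ = C (n + 2) * N := by field_simp
  have hmv := norm_image_sub_le_of_norm_deriv_le_segment' (f := H)
    (fun r _ => (hd r).hasDerivWithinAt) hderiv r₀ (right_mem_Icc.mpr hr₀.le)
  rw [h0, Real.norm_eq_abs, sub_zero] at hmv
  calc |h p| = |H r₀ - (H r₀ - h p)| := by ring_nf
    _ ≤ |H r₀| + |H r₀ - h p| := abs_sub _ _
    _ ≤ A * N + C (n + 2) * N * r₀ := add_le_add hr hmv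
    _ = _ := by ring

/-! ### Jets of smooth functions and limits -/

/-- The algebra of smooth functions. -/
def smoothFun (n : ℕ) : Subalgebra ℝ (Space n → ℝ) where
  carrier := {φ | ContDiff ℝ ∞ φ}
  mul_mem' {φ ψ} hφ hψ := by
    have h1 : ContDiff ℝ ∞ φ := hφ
    exact h1.mul (show ContDiff ℝ ∞ ψ from hψ)
  add_mem' {φ ψ} hφ hψ := by
    have h1 : ContDiff ℝ ∞ φ := hφ
    exact h1.add (show ContDiff ℝ ∞ ψ from hψ)
  algebraMap_mem' c := by
    change ContDiff ℝ ∞ fun _ => c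
    exact contDiff_const

lemma smoothFun_prod_apply {p : ℕ} (φ : Fin p → smoothFun n) :
    ((∏ j, φ j : smoothFun n) : Space n → ℝ) = fun x => ∏ j, (φ j : Space n → ℝ) x := by
  funext x
  simp

lemma memLp_horDeriv {D : Set (Space n)} (hD : Bornology.IsBounded D) (I : List (FrameIdx n))
    (φ : smoothFun n) : MemLp (horDeriv I φ.1) 2 (volume.restrict D) :=
  memLp_of_continuous hD (continuous_horDeriv I φ.2)

/-- The jet `(X_I φ)_{|I| ≤ s}` of a smooth function on a bounded set. -/
def jet {D : Set (Space n)} (hD : Bornology.IsBounded D) (s : ℕ) :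
    smoothFun n →ₗ[ℝ] JetL2 D s where
  toFun φ := WithLp.toLp 2 fun I => (memLp_horDeriv hD I.1 φ).toLp _
  map_add' φ ψ := by
    ext1 I
    exact (MemLp.toLp_congr (memLp_horDeriv hD I.1 (φ + ψ))
      ((memLp_horDeriv hD I.1 φ).add (memLp_horDeriv hD I.1 ψ))
      (Filter.EventuallyEq.of_eq (horDeriv_add I.1 φ.2 ψ.2))).trans
      (MemLp.toLp_add (memLp_horDeriv hD I.1 φ) (memLp_horDeriv hD I.1 ψ))
  map_smul' c φ := by
    ext1 I
    exact (MemLp.toLp_congr (memLp_horDeriv hD I.1 (c • φ))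
      ((memLp_horDeriv hD I.1 φ).const_smul c)
      (Filter.EventuallyEq.of_eq (horDeriv_smul I.1 c φ.2))).trans
      (MemLp.toLp_const_smul c (memLp_horDeriv hD I.1 φ))

lemma jet_ae {D : Set (Space n)} (hD : Bornology.IsBounded D) (s : ℕ) (φ : smoothFun n)
    (I : MultiIdx n s) : jet hD s φ I =ᵐ[volume.restrict D] horDeriv I.1 φ.1 :=
  (memLp_horDeriv hD I.1 φ).coeFn_toLp

lemma jet_mem {D : Set (Space n)} (hD : Bornology.IsBounded D) (s : ℕ) (φ : smoothFun n) :
    jet hD s φ ∈ smoothJets D s := ⟨φ.1, φ.2, jet_ae hD s φ⟩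

lemma exists_jet_eq {D : Set (Space n)} (hD : Bornology.IsBounded D) {s : ℕ} {F : JetL2 D s}
    (hF : F ∈ smoothJets D s) : ∃ φ, jet hD s φ = F := by
  obtain ⟨φ, hφ, h⟩ := hF
  refine ⟨⟨φ, hφ⟩, ?_⟩
  ext1 I
  exact Lp.ext ((jet_ae hD s ⟨φ, hφ⟩ I).trans (h I).symm)

lemma norm_jet_apply {D : Set (Space n)} (hD : Bornology.IsBounded D) (s : ℕ) (φ : smoothFun n)
    (I : MultiIdx n s) : ‖jet hD s φ I‖ = l2Norm D (horDeriv I.1 φ.1) :=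
  Lp.norm_toLp _ (memLp_horDeriv hD I.1 φ)

lemma l2Norm_le_norm_jet {D : Set (Space n)} (hD : Bornology.IsBounded D) (s : ℕ)
    (φ : smoothFun n) (I : MultiIdx n s) : l2Norm D (horDeriv I.1 φ.1) ≤ ‖jet hD s φ‖ := by
  rw [← norm_jet_apply hD]
  exact PiLp.norm_apply_le _ I

lemma norm_jet_le {D : Set (Space n)} (hD : Bornology.IsBounded D) (s : ℕ) (φ : smoothFun n) :
    ‖jet hD s φ‖ ≤ derivNorm D s φ.1 := by
  rw [PiLp.norm_eq_of_L2, derivNorm]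
  refine Real.sqrt_le_iff.mpr ⟨Finset.sum_nonneg fun _ _ => l2Norm_nonneg _ _, ?_⟩
  simp only [norm_jet_apply]
  exact Finset.sum_sq_le_sq_sum_of_nonneg fun _ _ => l2Norm_nonneg _ _

lemma norm_jet_mono {D : Set (Space n)} (hD : Bornology.IsBounded D) {s t : ℕ} (h : t ≤ s)
    (φ : smoothFun n) : ‖jet hD t φ‖ ≤ ‖jet hD s φ‖ := by
  rw [PiLp.norm_eq_of_L2, PiLp.norm_eq_of_L2]
  refine Real.sqrt_le_sqrt ?_
  simp only [norm_jet_apply]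
  let emb : MultiIdx n t ↪ MultiIdx n s :=
    ⟨fun I => ⟨I.1, I.2.trans h⟩, fun I J hIJ => Subtype.ext (Subtype.mk.inj hIJ)⟩
  refine (Finset.sum_map Finset.univ emb fun I => l2Norm D (horDeriv I.1 φ.1) ^ 2).symm.trans_le ?_
  exact Finset.sum_le_sum_of_subset_of_nonneg (Finset.subset_univ _) fun _ _ _ => sq_nonneg _

lemma derivNorm_horDeriv_le {D : Set (Space n)} (hD : Bornology.IsBounded D) {s m : ℕ}
    {I : List (FrameIdx n)} (h : I.length + m ≤ s) (φ : smoothFun n) :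
    derivNorm D m (horDeriv I φ.1) ≤ Fintype.card (MultiIdx n m) * ‖jet hD s φ‖ := by
  rw [derivNorm, ← nsmul_eq_mul]
  refine Finset.sum_le_card_nsmul _ _ _ fun J _ => ?_
  rw [← horDeriv_append]
  have hl : (J.1 ++ I).length ≤ s := by
    have := J.2
    rw [List.length_append]
    omega
  exact l2Norm_le_norm_jet hD s φ ⟨J.1 ++ I, hl⟩

open Filter Topology in
/-- If the jets of smooth functions converge in `L²` and the functions converge almost everywhere,
then the limit lies in the Folland–Stein space. -/
lemma memFS_of_cauchySeq {D : Set (Space n)} (hDo : IsOpen D) (hD : Bornology.IsBounded D) {s : ℕ}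
    {u : ℕ → smoothFun n} {f : Space n → ℝ} (hc : CauchySeq fun m => jet hD s (u m))
    (hf : ∀ᵐ x ∂volume.restrict D, Tendsto (fun m => (u m).1 x) atTop (𝓝 (f x))) :
    MemFS D s f ∧ Tendsto (fun m => ‖jet hD s (u m)‖) atTop (𝓝 (fsNorm D s f)) := by
  obtain ⟨F, hF⟩ := cauchySeq_tendsto_of_complete hc
  have hFm : F ∈ fsSpace D s :=
    mem_closure_of_tendsto hF (Eventually.of_forall fun m => jet_mem hD s (u m))
  have hF0 : Tendsto (fun m => jet hD s (u m) (emptyIdx n s)) atTop (𝓝 (F (emptyIdx n s))) :=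
    ((PiLp.continuous_apply 2 _ (emptyIdx n s)).tendsto F).comp hF
  -- Almost everywhere convergence of an `L²` convergent sequence holds along a subsequence, which
  -- is enough to identify the limit with `f`.
  obtain ⟨ns, hns, hlim⟩ := (tendstoInMeasure_of_tendsto_Lp hF0).exists_seq_tendsto_ae
  have hae : F (emptyIdx n s) =ᵐ[volume.restrict D] f := by
    have h1 : ∀ᵐ x ∂volume.restrict D, ∀ m, jet hD s (u m) (emptyIdx n s) x = (u m).1 x :=
      ae_all_iff.mpr fun m => jet_ae hD s (u m) (emptyIdx n s)
    filter_upwards [hf, hlim, h1] with x h2 h3 h4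
    simp only [h4] at h3
    exact tendsto_nhds_unique h3 (h2.comp hns.tendsto_atTop)
  refine ⟨⟨F, hFm, hae⟩, ?_⟩
  rw [fsNorm_eq hDo hFm hae]
  exact hF.norm

open Filter Topology in
/-- Approximation of elements of the Folland–Stein space by smooth functions. -/
lemma MemFS.exists_seq {D : Set (Space n)} (hD : Bornology.IsBounded D) {s : ℕ}
    {f : Space n → ℝ} (hf : MemFS D s f) : ∃ u : ℕ → smoothFun n,
      CauchySeq (fun m => jet hD s (u m)) ∧
      ∀ᵐ x ∂volume.restrict D, Tendsto (fun m => (u m).1 x) atTop (𝓝 (f x)) := by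
  obtain ⟨F, hF, hFf⟩ := hf
  obtain ⟨x, hx, hlim⟩ := mem_closure_iff_seq_limit.mp hF
  choose v hv using fun m => exists_jet_eq hD (hx m)
  have hF0 : Tendsto (fun m => jet hD s (v m) (emptyIdx n s)) atTop (𝓝 (F (emptyIdx n s))) := by
    simp only [hv]
    exact ((PiLp.continuous_apply 2 _ (emptyIdx n s)).tendsto F).comp hlim
  obtain ⟨ns, hns, hae⟩ := (tendstoInMeasure_of_tendsto_Lp hF0).exists_seq_tendsto_ae
  refine ⟨fun m => v (ns m), ?_, ?_⟩
  · simp only [hv]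
    exact (hlim.comp hns.tendsto_atTop).cauchySeq
  · have h1 : ∀ᵐ x ∂volume.restrict D, ∀ m, jet hD s (v m) (emptyIdx n s) x = (v m).1 x :=
      ae_all_iff.mpr fun m => jet_ae hD s (v m) (emptyIdx n s)
    filter_upwards [hae, h1, hFf] with x h2 h3 h4
    simpa only [h3, h4] using h2

open Filter Topology in
-- The product estimate mixes the orders `s` and `s'`, so a single approximating sequence has to
-- compute the norms of both.
lemma tendsto_norm_jet_of_le {D : Set (Space n)} (hDo : IsOpen D) (hD : Bornology.IsBounded D)
    {s t : ℕ} (hts : t ≤ s) {u : ℕ → smoothFun n} {f : Space n → ℝ}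
    (hc : CauchySeq fun m => jet hD s (u m))
    (hf : ∀ᵐ x ∂volume.restrict D, Tendsto (fun m => (u m).1 x) atTop (𝓝 (f x))) :
    Tendsto (fun m => ‖jet hD t (u m)‖) atTop (𝓝 (fsNorm D t f)) := by
  refine (memFS_of_cauchySeq hDo hD ?_ hf).2
  rw [Metric.cauchySeq_iff] at hc ⊢
  intro ε hε
  obtain ⟨N, hN⟩ := hc ε hε
  refine ⟨N, fun m hm k hk => ?_⟩
  have := hN m hm k hk
  rw [dist_eq_norm, ← map_sub] at this ⊢
  exact (norm_jet_mono hD hts _).trans_lt this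

lemma fsNorm_nonneg (D : Set (Space n)) (s : ℕ) (f : Space n → ℝ) : 0 ≤ fsNorm D s f := by
  unfold fsNorm
  split_ifs
  exacts [norm_nonneg _, le_rfl]

/-! ### Products -/

/-- The value of a horizontal derivative is controlled by a Folland–Stein norm. -/
lemma exists_abs_horDeriv_le (hn : 1 ≤ n) {D' D : Set (Space n)} (hD : IsOpen D)
    (hDb : Bornology.IsBounded D) (hsub : closure D' ⊆ D) :
    ∃ B : ℝ, 0 ≤ B ∧ ∀ (s : ℕ) (I : List (FrameIdx n)), I.length + (n + 2) ≤ s →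
      ∀ φ : smoothFun n, ∀ x ∈ D', |horDeriv I φ.1 x| ≤ B * ‖jet hDb s φ‖ := by
  have hK : IsCompact (closure D') := (hDb.subset (subset_closure.trans hsub)).isCompact_closure
  obtain ⟨C, hC, h⟩ := exists_sobolev hn hK hD hDb hsub
  refine ⟨C * Fintype.card (MultiIdx n (n + 2)), by positivity, fun s I hI φ x hx => ?_⟩
  rw [mul_assoc]
  exact (h _ (horDeriv_contDiff I φ.2) x (subset_closure hx)).trans
    (mul_le_mul_of_nonneg_left (derivNorm_horDeriv_le hDb hI φ) hC)

/-- In each Leibniz term the factor with the most derivatives is kept in `L²`, and every other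
factor is replaced by its Sobolev bound. The condition on `s'` is exactly what this requires. -/
lemma exists_norm_jet_prod_le (hn : 1 ≤ n) {s s' p : ℕ} (hs : s / 2 + (n + 2) ≤ s') (hp : 1 ≤ p)
    {D' D : Set (Space n)} (hD' : IsOpen D') (hD : IsOpen D) (hDb : Bornology.IsBounded D)
    (hDb' : Bornology.IsBounded D') (hsub : closure D' ⊆ D) :
    ∃ C : ℝ, 0 < C ∧ ∀ φ : Fin p → smoothFun n, ‖jet hDb' s (∏ j, φ j)‖ ≤
      C * ∑ k, ‖jet hDb s (φ k)‖ * ∏ j ∈ Finset.univ.erase k, ‖jet hDb s' (φ j)‖ := by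
  obtain ⟨B, hB, hsup⟩ := exists_abs_horDeriv_le hn hD hDb hsub
  have hDD : D' ⊆ D := subset_closure.trans hsub
  have key : ∀ I : MultiIdx n s, ∃ C : ℝ, 0 ≤ C ∧ ∀ φ : Fin p → smoothFun n,
      l2Norm D' (horDeriv I.1 (∏ j, φ j : smoothFun n).1) ≤
        C * ∑ k, ‖jet hDb s (φ k)‖ * ∏ j ∈ Finset.univ.erase k, ‖jet hDb s' (φ j)‖ := by
    intro I
    obtain ⟨ι, _, J, hJ, hprod⟩ := exists_horDeriv_prod p I.1
    have hne : (Finset.univ : Finset (Fin p)).Nonempty := ⟨⟨0, hp⟩, Finset.mem_univ _⟩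
    choose k _ hk using fun e => Finset.exists_max_image _ (fun j => (J e j).length) hne
    have hlen : ∀ e j, (J e j).length ≤ s := fun e j =>
      (Finset.single_le_sum (f := fun j => (J e j).length) (fun _ _ => Nat.zero_le _)
        (Finset.mem_univ j)).trans ((hJ e).le.trans I.2)
    -- Such a multi-index is no longer than the longest one, and the two lengths add up to at most
    -- `s`; so its length is at most `s / 2`.
    have hhalf : ∀ e, ∀ j ∈ Finset.univ.erase (k e), (J e j).length + (n + 2) ≤ s' := by
      intro e j hj
      have h1 := hk e j (Finset.mem_univ j)
      have h2 := (hJ e).le.trans I.2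
      rw [← Finset.add_sum_erase _ _ (Finset.mem_univ (k e)), ← Finset.add_sum_erase _ _ hj] at h2
      omega
    -- One Sobolev constant `B` for each of the `p - 1` factors other than `k e`.
    refine ⟨∑ _e : ι, B ^ (p - 1), by positivity, fun φ => ?_⟩
    set S := ∑ k, ‖jet hDb s (φ k)‖ * ∏ j ∈ Finset.univ.erase k, ‖jet hDb s' (φ j)‖ with hS
    have hpt : ∀ x ∈ D', |horDeriv I.1 (∏ j, φ j : smoothFun n).1 x| ≤
        ∑ e, (∏ j ∈ Finset.univ.erase (k e), B * ‖jet hDb s' (φ j)‖) *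
          |horDeriv (J e (k e)) (φ (k e)).1 x| := by
      intro x hx
      rw [smoothFun_prod_apply, hprod _ fun j => (φ j).2]
      refine (Finset.abs_sum_le_sum_abs _ _).trans (Finset.sum_le_sum fun e _ => ?_)
      rw [Finset.abs_prod, ← Finset.prod_erase_mul _ _ (Finset.mem_univ (k e))]
      refine mul_le_mul_of_nonneg_right ?_ (abs_nonneg _)
      exact Finset.prod_le_prod (fun _ _ => abs_nonneg _) fun j hj =>
        hsup s' _ (hhalf e j hj) (φ j) x hx
    refine (l2Norm_le_sum hD'.measurableSet
      (fun e => Finset.prod_nonneg fun j _ => mul_nonneg hB (norm_nonneg _))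
      (fun e => memLp_horDeriv hDb' (J e (k e)) (φ (k e))) hpt).trans ?_
    rw [Finset.sum_mul]
    refine Finset.sum_le_sum fun e _ => ?_
    rw [Finset.prod_mul_distrib, Finset.prod_const, Finset.card_erase_of_mem (Finset.mem_univ _),
      Finset.card_univ, Fintype.card_fin, mul_assoc]
    refine mul_le_mul_of_nonneg_left ?_ (pow_nonneg hB _)
    have h1 : l2Norm D' (horDeriv (J e (k e)) (φ (k e)).1) ≤ ‖jet hDb s (φ (k e))‖ :=
      (l2Norm_mono hDD (memLp_horDeriv hDb _ _)).trans
        (l2Norm_le_norm_jet hDb s (φ (k e)) ⟨_, hlen e (k e)⟩)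
    have h0 : ∀ k ∈ (Finset.univ : Finset (Fin p)), 0 ≤ ‖jet hDb s (φ k)‖ *
        ∏ j ∈ Finset.univ.erase k, ‖jet hDb s' (φ j)‖ := fun k _ =>
      mul_nonneg (norm_nonneg _) (Finset.prod_nonneg fun _ _ => norm_nonneg _)
    refine le_trans ?_ (Finset.single_le_sum h0 (Finset.mem_univ (k e)))
    rw [mul_comm]
    exact mul_le_mul_of_nonneg_right h1 (Finset.prod_nonneg fun _ _ => norm_nonneg _)
  choose C hC hCle using key
  -- The summand `1` only ensures strict positivity.
  refine ⟨∑ I, C I + 1, by linarith [Finset.sum_nonneg fun I (_ : I ∈ Finset.univ) => hC I],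
    fun φ => ?_⟩
  have hS : 0 ≤ ∑ k, ‖jet hDb s (φ k)‖ * ∏ j ∈ Finset.univ.erase k, ‖jet hDb s' (φ j)‖ :=
    Finset.sum_nonneg fun _ _ =>
      mul_nonneg (norm_nonneg _) (Finset.prod_nonneg fun _ _ => norm_nonneg _)
  calc ‖jet hDb' s (∏ j, φ j)‖ ≤ derivNorm D' s (∏ j, φ j : smoothFun n).1 := norm_jet_le _ _ _
    _ ≤ ∑ I, C I * _ := Finset.sum_le_sum fun I _ => hCle I φ
    _ = (∑ I, C I) * _ := (Finset.sum_mul _ _ _).symm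
    _ ≤ _ := mul_le_mul_of_nonneg_right (by linarith) hS

open Filter Topology in
/-- Products of Cauchy sequences are Cauchy sequences, for a multilinear map that is bounded with
respect to a seminorm. -/
lemma cauchySeq_multilinear {E F H : Type*} [AddCommGroup E] [Module ℝ E] [NormedAddCommGroup F]
    [NormedSpace ℝ F] [NormedAddCommGroup H] [NormedSpace ℝ H] {p : ℕ} (N : E →ₗ[ℝ] F)
    (P : MultilinearMap ℝ (fun _ : Fin p => E) H) {C : ℝ} (hC : 0 ≤ C)
    (hP : ∀ v, ‖P v‖ ≤ C * ∏ j, ‖N (v j)‖) {u : Fin p → ℕ → E}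
    (hu : ∀ j, CauchySeq fun m => N (u j m)) : CauchySeq fun m => P fun j => u j m := by
  -- `E` receives the seminorm pulled back along `N`, so that the standard difference estimate for
  -- bounded multilinear maps applies.
  let _ : SeminormedAddCommGroup E := SeminormedAddCommGroup.induced E F N
  let _ : NormedSpace ℝ E := NormedSpace.induced ℝ E F N
  have hu' : CauchySeq fun m => fun j => u j m := by
    rw [Metric.cauchySeq_iff']
    intro ε hε
    choose k hk using fun j => (Metric.cauchySeq_iff.mp (hu j)) (ε / 2) (half_pos hε)
    refine ⟨Finset.univ.sup k, fun m hm => ?_⟩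
    refine lt_of_le_of_lt ((dist_pi_le_iff (half_pos hε).le).mpr fun j => ?_) (half_lt_self hε)
    have h1 : k j ≤ Finset.univ.sup k := Finset.le_sup (Finset.mem_univ j)
    have h2 := (hk j m (h1.trans hm) _ h1).le
    rw [dist_eq_norm, ← map_sub] at h2
    rw [dist_eq_norm]
    exact h2
  obtain ⟨R, -, hR⟩ := cauchySeq_bdd hu'
  set b : ℝ := ‖fun j => u j 0‖ + R with hb
  have hbound : ∀ m, ‖fun j => u j m‖ ≤ b := fun m => by
    have h1 := norm_le_norm_add_norm_sub' (fun j => u j m) (fun j => u j 0)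
    have h2 := (hR m 0).le
    rw [dist_eq_norm] at h2
    linarith
  rw [Metric.cauchySeq_iff] at hu' ⊢
  intro ε hε
  have hb0 : 0 ≤ b := (norm_nonneg _).trans (hbound 0)
  set A : ℝ := C * Fintype.card (Fin p) * b ^ (Fintype.card (Fin p) - 1) with hA
  have hA0 : 0 ≤ A := by positivity
  obtain ⟨N₀, hN₀⟩ := hu' (ε / (A + 1)) (by positivity)
  refine ⟨N₀, fun m hm k hk => ?_⟩
  have h1 := hN₀ m hm k hk
  rw [dist_eq_norm] at h1 ⊢
  have h2 := P.norm_image_sub_le_of_bound hC hP (fun j => u j m) (fun j => u j k)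
  have h3 : max ‖fun j => u j m‖ ‖fun j => u j k‖ ≤ b := max_le (hbound m) (hbound k)
  calc _ ≤ C * Fintype.card (Fin p) * max ‖fun j => u j m‖ ‖fun j => u j k‖ ^
        (Fintype.card (Fin p) - 1) * ‖(fun j => u j m) - fun j => u j k‖ := h2
    _ ≤ A * ‖(fun j => u j m) - fun j => u j k‖ := by
        rw [hA]
        gcongr
    _ ≤ A * (ε / (A + 1)) := mul_le_mul_of_nonneg_left h1.le hA0
    _ < ε := by
        rw [mul_div_assoc', div_lt_iff₀ (by positivity)]
        linarith

open Filter Topology in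
/-- The local product estimate. -/
theorem exists_fsNorm_prod_le (hn : 1 ≤ n) {s s' p : ℕ} (hs : s / 2 + (n + 2) ≤ s')
    (hs' : s' ≤ s) (hp : 1 ≤ p) {D' D : Set (Space n)} (hD' : IsOpen D') (hD : IsOpen D)
    (hDb : Bornology.IsBounded D) (hsub : closure D' ⊆ D) :
    ∃ C : ℝ, 0 < C ∧ ∀ f : Fin p → Space n → ℝ, (∀ j, MemFS D s (f j)) →
      MemFS D' s (fun x => ∏ j, f j x) ∧ fsNorm D' s (fun x => ∏ j, f j x) ≤
        C * ∑ k, fsNorm D s (f k) * ∏ j ∈ Finset.univ.erase k, fsNorm D s' (f j) := by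
  have hDD : D' ⊆ D := subset_closure.trans hsub
  have hDb' : Bornology.IsBounded D' := hDb.subset hDD
  obtain ⟨C, hC, hle⟩ := exists_norm_jet_prod_le hn hs hp hD' hD hDb hDb' hsub
  -- The case `s' = s` bounds the product by a multiple of the product of norms of order `s`. It
  -- serves only to show that the products form a Cauchy sequence; the asserted bound uses `C`.
  obtain ⟨C₁, hC₁, hle₁⟩ := exists_norm_jet_prod_le hn (hs.trans hs') hp hD' hD hDb hDb' hsub
  refine ⟨C, hC, fun f hf => ?_⟩
  choose u hu hae using fun j => (hf j).exists_seq hDb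
  have hcauchy : CauchySeq fun m => jet hDb' s (∏ j, u j m) := by
    have := cauchySeq_multilinear (p := p) (jet hDb s)
      ((jet hDb' s).compMultilinearMap (MultilinearMap.mkPiAlgebra ℝ (Fin p) (smoothFun n)))
      (C := C₁ * p) (by positivity) (fun v => ?_) hu
    · simpa using this
    · refine (hle₁ v).trans (le_of_eq ?_)
      rw [mul_assoc]
      congr 1
      rw [Finset.sum_congr rfl fun k _ => Finset.mul_prod_erase _ (fun j => ‖jet hDb s (v j)‖)
        (Finset.mem_univ k)]
      simp
  have haeprod : ∀ᵐ x ∂volume.restrict D',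
      Tendsto (fun m => (∏ j, u j m : smoothFun n).1 x) atTop (𝓝 (∏ j, f j x)) := by
    have h1 : ∀ᵐ x ∂volume.restrict D', ∀ j, Tendsto (fun m => (u j m).1 x) atTop (𝓝 (f j x)) :=
      ae_all_iff.mpr fun j => ae_restrict_of_ae_restrict_of_subset hDD (hae j)
    filter_upwards [h1] with x hx
    simp only [smoothFun_prod_apply]
    exact tendsto_finsetProd _ fun j _ => hx j
  obtain ⟨h1, h2⟩ := memFS_of_cauchySeq hD' hDb' hcauchy haeprod
  refine ⟨h1, le_of_tendsto_of_tendsto' h2 (Tendsto.const_mul C ?_) fun m => hle fun j => u j m⟩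
  exact tendsto_finsetSum _ fun k _ =>
    (tendsto_norm_jet_of_le hD hDb le_rfl (hu k) (hae k)).mul
      (tendsto_finsetProd _ fun j _ => tendsto_norm_jet_of_le hD hDb hs' (hu j) (hae j))

/-! ### Contact changes of coordinates -/

/-- Horizontal derivatives of `a · (u ∘ τ)` for a map `τ` that preserves the contact structure. -/
lemma exists_horDeriv_comp {W : Set (Space n)} (hW : IsOpen W) {τ : Space n → Space n}
    (hτ : ContDiffOn ℝ ∞ τ W)
    (hcontact : ∀ y ∈ W, ∀ v, stdForm y v = 0 → stdForm (τ y) (fderiv ℝ τ y v) = 0)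
    {a : Space n → ℝ} (ha : ContDiffOn ℝ ∞ a W) (I : List (FrameIdx n)) :
    ∃ (ι : Type) (_ : Fintype ι) (c : ι → Space n → ℝ) (J : ι → List (FrameIdx n)),
      (∀ e, ContDiffOn ℝ ∞ (c e) W) ∧ (∀ e, (J e).length ≤ I.length) ∧
      ∀ u : Space n → ℝ, ContDiff ℝ ∞ u → ∀ y ∈ W,
        horDeriv I (fun y => a y * u (τ y)) y = ∑ e, c e y * horDeriv (J e) u (τ y) := by
  induction I with
  | nil => exact ⟨Unit, inferInstance, fun _ => a, fun _ => [], fun _ => ha, fun _ => le_rfl,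
      fun u _ y _ => by simp [horDeriv]⟩
  | cons i I ih =>
    obtain ⟨ι, _, c, J, hc, hJ, h⟩ := ih
    have hτ' : ContDiffOn ℝ ∞ (fun y => fderiv ℝ τ y (frame i y)) W :=
      (hτ.fderiv_of_isOpen hW (m := ∞) (by simp)).clm_apply (frame_contDiff i).contDiffOn
    -- The new derivative falls either on a coefficient (left) or on a derivative of `u` composed
    -- with `τ` (right). In the second case the chain rule contributes the components of `dτ(X_i)`
    -- in the frame.
    refine ⟨ι ⊕ ι × FrameIdx n, inferInstance,
      Sum.elim (fun e y => fderiv ℝ (c e) y (frame i y))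
        fun e y => c e.1 y * (fderiv ℝ τ y (frame i y)) (frameCoord e.2),
      Sum.elim J fun e => e.2 :: J e.1, ?_, ?_, ?_⟩
    · rintro (e | ⟨e, k⟩)
      · exact ((hc e).fderiv_of_isOpen hW (m := ∞) (by simp)).clm_apply
          (frame_contDiff i).contDiffOn
      · exact (hc e).mul
          ((EuclideanSpace.proj (𝕜 := ℝ) (frameCoord k)).contDiff.comp_contDiffOn hτ')
    · rintro (e | ⟨e, k⟩)
      · exact (hJ e).trans (Nat.le_succ _)
      · exact Nat.succ_le_succ (hJ e)
    · intro u hu y hy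
      have hev : horDeriv I (fun y => a y * u (τ y)) =ᶠ[nhds y]
          fun y => ∑ e, c e y * horDeriv (J e) u (τ y) := by
        filter_upwards [hW.mem_nhds hy] with z hz using h u hu z hz
      have hdτ : HasFDerivAt τ (fderiv ℝ τ y) y :=
        ((hτ.contDiffAt (hW.mem_nhds hy)).differentiableAt (by simp)).hasFDerivAt
      have hd : ∀ e, HasFDerivAt (fun y => c e y * horDeriv (J e) u (τ y))
          (c e y • (fderiv ℝ (horDeriv (J e) u) (τ y)).comp (fderiv ℝ τ y) +
            horDeriv (J e) u (τ y) • fderiv ℝ (c e) y) y := fun e =>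
        (((hc e).contDiffAt (hW.mem_nhds hy)).differentiableAt (by simp)).hasFDerivAt.mul
          ((differentiable_horDeriv (J e) hu (τ y)).hasFDerivAt.comp y hdτ)
      change fderiv ℝ _ y (frame i y) = _
      rw [hev.fderiv_eq, (HasFDerivAt.fun_sum fun e _ => hd e).fderiv, sum_apply,
        Fintype.sum_sum_type, Fintype.sum_prod_type, ← Finset.sum_add_distrib]
      refine Finset.sum_congr rfl fun e _ => ?_
      -- Since `τ` preserves the contact hyperplanes, `dτ(X_i)` has no vertical component. A
      -- vertical derivative would count as two horizontal ones and spoil the order.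
      have hdec := frame_decomposition (τ y) (fderiv ℝ τ y (frame i y))
      rw [hcontact y hy _ (stdForm_frame i y), zero_smul, add_zero] at hdec
      simp only [add_apply, smul_apply, ContinuousLinearMap.comp_apply, smul_eq_mul, Sum.elim_inl,
        Sum.elim_inr]
      conv_lhs => rw [hdec]
      rw [map_sum, Finset.mul_sum, add_comm]
      congr 1
      · ring
      · refine Finset.sum_congr rfl fun k _ => ?_
        rw [map_smul, smul_eq_mul, mul_assoc]
        rfl

lemma horDeriv_zero (I : List (FrameIdx n)) : horDeriv I (fun _ : Space n => (0 : ℝ)) = 0 := by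
  have := horDeriv_smul I (0 : ℝ) (φ := fun _ : Space n => (0 : ℝ)) contDiff_const
  rw [zero_smul, zero_smul] at this
  exact this

lemma horDeriv_eq_zero {φ : Space n → ℝ} {L : Set (Space n)} (hL : IsClosed L)
    (h : ∀ x ∉ L, φ x = 0) (I : List (FrameIdx n)) {x : Space n} (hx : x ∉ L) :
    horDeriv I φ x = 0 := by
  have := horDeriv_eqOn hL.isOpen_compl I (ψ := fun _ => 0) (fun x hx => h x hx) hx
  rw [this, horDeriv_zero]
  rfl

lemma l2Norm_le_of_support {D L : Set (Space n)} (hL : MeasurableSet L) {g : Space n → ℝ}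
    (h : ∀ x ∉ L, g x = 0) (hg : MemLp g 2 (volume.restrict L)) : l2Norm D g ≤ l2Norm L g := by
  refine ENNReal.toReal_mono hg.2.ne ?_
  have e : g = L.indicator g := by
    funext x
    by_cases hx : x ∈ L
    · rw [indicator_of_mem hx]
    · rw [indicator_of_notMem hx, h x hx]
  conv_lhs => rw [e]
  rw [eLpNorm_indicator_eq_eLpNorm_restrict hL]
  exact eLpNorm_mono_measure g (Measure.restrict_mono_measure Measure.restrict_le_self L)

/-- Multiplication of `u ∘ τ` by a cutoff function. -/
def cutComp (W : Set (Space n)) (hW : IsOpen W) (τ : Space n → Space n)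
    (hτ : ContDiffOn ℝ ∞ τ W) (a : Space n → ℝ) (ha : ContDiff ℝ ∞ a) (haW : tsupport a ⊆ W) :
    smoothFun n →ₗ[ℝ] smoothFun n where
  toFun u := ⟨fun y => a y * u.1 (τ y), by
    have hu : ContDiff ℝ ∞ u.1 := u.2
    change ContDiff ℝ ∞ fun y => a y * u.1 (τ y)
    refine contDiff_iff_contDiffAt.mpr fun y => ?_
    by_cases hy : y ∈ tsupport a
    · exact ha.contDiffAt.mul
        (hu.contDiffAt.comp y (hτ.contDiffAt (hW.mem_nhds (haW hy))))
    · have : (fun y => a y * u.1 (τ y)) =ᶠ[nhds y] fun _ => 0 := by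
        filter_upwards [(isClosed_tsupport a).isOpen_compl.mem_nhds hy] with z hz
        rw [image_eq_zero_of_notMem_tsupport hz, zero_mul]
      exact contDiffAt_const.congr_of_eventuallyEq this⟩
  map_add' u v := Subtype.ext (funext fun y => mul_add _ _ _)
  map_smul' c u := Subtype.ext (funext fun y => mul_left_comm _ _ _)

open Filter Topology in
/-- Boundedness of a contact change of coordinates, followed by multiplication with a cutoff
function, between Folland–Stein spaces. -/
theorem exists_fsNorm_comp_le (s : ℕ) {W D D' : Set (Space n)} (hW : IsOpen W) (hD : IsOpen D)
    (hDb : Bornology.IsBounded D) (hD' : IsOpen D') (hDb' : Bornology.IsBounded D')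
    {τ : Space n → Space n} (hτ : ContDiffOn ℝ ∞ τ W)
    (hcontact : ∀ y ∈ W, ∀ v, stdForm y v = 0 → stdForm (τ y) (fderiv ℝ τ y v) = 0)
    (hinj : InjOn τ W) (hdet : ∀ y ∈ W, (fderiv ℝ τ y).det ≠ 0)
    {a : Space n → ℝ} (ha : ContDiff ℝ ∞ a) (hac : HasCompactSupport a) (haW : tsupport a ⊆ W)
    (hmaps : MapsTo τ (tsupport a) D') :
    ∃ C : ℝ, 0 ≤ C ∧ ∀ f, MemFS D' s f → MemFS D s (fun y => a y * f (τ y)) ∧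
      fsNorm D s (fun y => a y * f (τ y)) ≤ C * fsNorm D' s f := by
  set L := tsupport a with hL
  have hLm : MeasurableSet L := (isClosed_tsupport a).measurableSet
  have hcdet : ContinuousOn (fun y => |(fderiv ℝ τ y).det|) L :=
    ((ContinuousLinearMap.continuous_det.comp_continuousOn
      (hτ.continuousOn_fderiv_of_isOpen hW (by simp))).abs).mono haW
  -- The Jacobian is continuous and nonzero on the compact support of `a`, hence bounded away from
  -- zero there.
  obtain ⟨c, hc, hcle⟩ : ∃ c : ℝ, 0 < c ∧ ∀ y ∈ L, c ≤ |(fderiv ℝ τ y).det| := by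
    rcases L.eq_empty_or_nonempty with h0 | h0
    · exact ⟨1, one_pos, by simp [h0]⟩
    · obtain ⟨y, hy, hmin⟩ := hac.exists_isMinOn h0 hcdet
      exact ⟨_, abs_pos.mpr (hdet y (haW hy)), fun z hz => hmin hz⟩
  obtain ⟨hm, hle⟩ := map_restrict_le hc hLm hD'.measurableSet
    (fun y hy => ((hτ.contDiffAt (hW.mem_nhds (haW hy))).differentiableAt
      (by simp)).hasFDerivAt.hasFDerivWithinAt) (hinj.mono haW) hmaps hcle
  let T := cutComp W hW τ hτ a ha haW
  have hT : ∀ u, (T u).1 = fun y => a y * u.1 (τ y) := fun u => rfl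
  have key : ∀ I : MultiIdx n s, ∃ C : ℝ, 0 ≤ C ∧ ∀ u : smoothFun n,
      l2Norm D (horDeriv I.1 (T u).1) ≤ C * ‖jet hDb' s u‖ := by
    intro I
    obtain ⟨ι, _, b, J, hb, hJ, hI⟩ := exists_horDeriv_comp hW hτ hcontact ha.contDiffOn I.1
    choose A hA using fun e => hac.exists_bound_of_continuousOn ((hb e).continuousOn.mono haW)
    refine ⟨∑ e, max (A e) 0 * (√c)⁻¹, by positivity, fun u => ?_⟩
    have hcomp : ∀ e, MemLp (horDeriv (J e) u.1 ∘ τ) 2 (volume.restrict L) ∧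
        l2Norm L (horDeriv (J e) u.1 ∘ τ) ≤ (√c)⁻¹ * l2Norm D' (horDeriv (J e) u.1) := fun e =>
      memLp_comp_of_map_le hc hm hle (continuous_horDeriv _ u.2) (memLp_horDeriv hDb' _ _)
    have hzero : ∀ y ∉ L, horDeriv I.1 (T u).1 y = 0 := fun y hy =>
      horDeriv_eq_zero (isClosed_tsupport a) (fun z hz => by
        simp only [hT]
        rw [image_eq_zero_of_notMem_tsupport hz, zero_mul]) I.1 hy
    refine (l2Norm_le_of_support hLm hzero
      (memLp_horDeriv (hac.isBounded) I.1 (T u))).trans ?_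
    refine (l2Norm_le_sum hLm (A := fun e => max (A e) 0) (fun e => le_max_right _ _)
      (fun e => (hcomp e).1) fun y hy => ?_).trans ?_
    · rw [hT, hI u.1 u.2 y (haW hy)]
      refine (Finset.abs_sum_le_sum_abs _ _).trans (Finset.sum_le_sum fun e _ => ?_)
      rw [abs_mul]
      exact mul_le_mul_of_nonneg_right ((hA e y hy).trans (le_max_left _ _)) (abs_nonneg _)
    · rw [Finset.sum_mul]
      refine Finset.sum_le_sum fun e _ => ?_
      rw [mul_assoc]
      refine mul_le_mul_of_nonneg_left ((hcomp e).2.trans ?_) (le_max_right _ _)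
      exact mul_le_mul_of_nonneg_left
        (l2Norm_le_norm_jet hDb' s u ⟨J e, (hJ e).trans I.2⟩) (by positivity)
  choose C hC hCle using key
  have hbound : ∀ u, ‖jet hDb s (T u)‖ ≤ (∑ I, C I) * ‖jet hDb' s u‖ := fun u =>
    (norm_jet_le _ _ _).trans (by
      rw [Finset.sum_mul]
      exact Finset.sum_le_sum fun I _ => hCle I u)
  have hC0 : 0 ≤ ∑ I, C I := Finset.sum_nonneg fun I _ => hC I
  refine ⟨∑ I, C I, hC0, fun f hf => ?_⟩
  obtain ⟨u, hu, hae⟩ := hf.exists_seq hDb'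
  have hcauchy : CauchySeq fun m => jet hDb s (T (u m)) := by
    rw [Metric.cauchySeq_iff] at hu ⊢
    intro ε hε
    obtain ⟨N, hN⟩ := hu (ε / (∑ I, C I + 1)) (by positivity)
    refine ⟨N, fun m hm k hk => ?_⟩
    have h1 := hN m hm k hk
    rw [dist_eq_norm, ← map_sub] at h1 ⊢
    rw [← map_sub]
    refine (hbound _).trans_lt ?_
    rw [lt_div_iff₀ (by positivity)] at h1
    nlinarith [norm_nonneg (jet hDb' s (u m - u k))]
  have hlim : ∀ᵐ y ∂volume.restrict D,
      Tendsto (fun m => (T (u m)).1 y) atTop (𝓝 (a y * f (τ y))) := by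
    -- Preimages under `τ` of null sets of `D'` are null in `L`, so almost everywhere convergence on
    -- `D'` carries over.
    have hac : (volume.restrict L).map τ ≪ volume.restrict D' :=
      (Measure.absolutelyContinuous_of_le hle).trans Measure.smul_absolutelyContinuous
    have h1 := ae_of_ae_map hm (hac.ae_le hae)
    rw [ae_restrict_iff' hLm] at h1
    filter_upwards [ae_restrict_of_ae h1] with y hy
    by_cases hyL : y ∈ L
    · exact (hy hyL).const_mul (a y)
    · have : a y = 0 := image_eq_zero_of_notMem_tsupport hyL
      simp [hT, this]
  obtain ⟨h1, h2⟩ := memFS_of_cauchySeq hD hDb hcauchy hlim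
  exact ⟨h1, le_of_tendsto_of_tendsto' h2
    ((memFS_of_cauchySeq hD' hDb' hu hae).2.const_mul _) fun m => hbound (u m)⟩

/-! ### Folland–Stein spaces on compact contact manifolds -/

lemma MemFS.congr {D : Set (Space n)} (hD : IsOpen D) {s : ℕ} {f g : Space n → ℝ}
    (hf : MemFS D s f) (h : EqOn f g D) : MemFS D s g ∧ fsNorm D s g = fsNorm D s f := by
  obtain ⟨F, hF, hFf⟩ := hf
  have hg : F (emptyIdx n s) =ᵐ[volume.restrict D] g :=
    hFf.trans ((ae_restrict_iff' hD.measurableSet).mpr (Filter.Eventually.of_forall h))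
  exact ⟨⟨F, hF, hg⟩, by rw [fsNorm_eq hD hF hg, fsNorm_eq hD hF hFf]⟩

lemma MemFS.sum {ι : Type*} [Fintype ι] {D : Set (Space n)} (hD : IsOpen D) {s : ℕ}
    {f : ι → Space n → ℝ} (hf : ∀ e, MemFS D s (f e)) :
    MemFS D s (fun x => ∑ e, f e x) ∧
      fsNorm D s (fun x => ∑ e, f e x) ≤ ∑ e, fsNorm D s (f e) := by
  choose F hF hFf using hf
  have hm : ∑ e, F e ∈ fsSpace D s := Submodule.sum_mem _ fun e _ => hF e
  have hae : (∑ e, F e) (emptyIdx n s) =ᵐ[volume.restrict D] fun x => ∑ e, f e x := by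
    have h1 : (∑ e, F e) (emptyIdx n s) = ∑ e, F e (emptyIdx n s) := by
      simp
    rw [h1]
    have h2 := Lp.coeFn_finsetSum Finset.univ fun e => F e (emptyIdx n s)
    have h3 : ∀ᵐ x ∂volume.restrict D, ∀ e, F e (emptyIdx n s) x = f e x :=
      ae_all_iff.mpr fun e => hFf e
    filter_upwards [h2, h3] with x h4 h5
    rw [h4]
    simp [h5]
  refine ⟨⟨_, hm, hae⟩, ?_⟩
  rw [fsNorm_eq hD hm hae]
  refine (norm_sum_le _ _).trans (le_of_eq (Finset.sum_congr rfl fun e _ => ?_))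
  rw [fsNorm_eq hD (hF e) (hFf e)]

lemma exists_cutoff {K U : Set (Space n)} (hK : IsCompact K) (hU : IsOpen U) (hKU : K ⊆ U) :
    ∃ θ : Space n → ℝ, ContDiff ℝ ∞ θ ∧ HasCompactSupport θ ∧ tsupport θ ⊆ U ∧
      ∀ x ∈ K, θ x = 1 := by
  obtain ⟨V, hV, hKV, hVU, hVc⟩ := exists_open_between_and_isCompact_closure hK hU hKU
  obtain ⟨θ, h1, h0, -⟩ := exists_contMDiffMap_one_nhds_of_subset_interior
    (modelWithCornersSelf ℝ (Space n)) (n := (⊤ : ℕ∞)) (t := V) hK.isClosed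
    (hV.interior_eq.symm ▸ hKV)
  have hsub : tsupport θ ⊆ closure V := closure_mono fun x hx => by
    by_contra hxV
    exact hx (h0 x hxV)
  exact ⟨θ, θ.contMDiff.contDiff, hVc.of_isClosed_subset (isClosed_tsupport _) hsub,
    hsub.trans hVU, fun x hx => h1.self_of_nhdsSet x hx⟩

section Contact

variable {M : Type*} [TopologicalSpace M] [ChartedSpace (Space n) M]
  {η : OneForm n M}

lemma IsAdaptedChart.mdifferentiable {φ : OpenPartialHomeomorph M (Space n)}
    (hφ : IsAdaptedChart η φ) :
    φ.MDifferentiable (𝓡 (2 * n + 1)) (𝓡 (2 * n + 1)) :=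
  ⟨(contMDiffOn_of_mem_maximalAtlas hφ.1).mdifferentiableOn (by simp),
    (contMDiffOn_symm_of_mem_maximalAtlas hφ.1).mdifferentiableOn (by simp)⟩

lemma IsAdaptedChart.contDiffOn_transition {φ ψ : OpenPartialHomeomorph M (Space n)}
    (hφ : IsAdaptedChart η φ) (hψ : IsAdaptedChart η ψ) :
    ContDiffOn ℝ ∞ (ψ ∘ φ.symm) (φ.symm.trans ψ).source := by
  rw [← contMDiffOn_iff_contDiffOn]
  refine (contMDiffOn_of_mem_maximalAtlas hψ.1).comp
    ((contMDiffOn_symm_of_mem_maximalAtlas hφ.1).mono ?_) ?_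
  · intro y hy
    exact hy.1
  · intro y hy
    exact hy.2

lemma IsAdaptedChart.fderiv_transition {φ ψ : OpenPartialHomeomorph M (Space n)}
    (hφ : IsAdaptedChart η φ) (hψ : IsAdaptedChart η ψ) {y : Space n}
    (hy : y ∈ (φ.symm.trans ψ).source) (v : Space n) :
    fderiv ℝ (ψ ∘ φ.symm) y v = mfderiv (𝓡 (2 * n + 1)) (𝓡 (2 * n + 1)) ψ (φ.symm y)
      (mfderiv (𝓡 (2 * n + 1)) (𝓡 (2 * n + 1)) φ.symm y v) := by
  have h := mfderiv_comp y (hψ.mdifferentiable.mdifferentiableAt hy.2)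
    (hφ.mdifferentiable.symm.mdifferentiableAt hy.1)
  rw [OpenPartialHomeomorph.symm_symm] at h
  have h1 := (mfderiv_eq_fderiv (𝕜 := ℝ) (f := ψ ∘ φ.symm) (x := y)).symm.trans h
  rw [h1]
  rfl

/-- Both charts pull `η₀` back to the same form `η`, so the transition preserves `η₀` itself and in
particular its kernel. -/
lemma IsAdaptedChart.stdForm_transition {φ ψ : OpenPartialHomeomorph M (Space n)}
    (hφ : IsAdaptedChart η φ) (hψ : IsAdaptedChart η ψ) {y : Space n}
    (hy : y ∈ (φ.symm.trans ψ).source) (v : Space n) :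
    stdForm ((ψ ∘ φ.symm) y) (fderiv ℝ (ψ ∘ φ.symm) y v) = stdForm y v := by
  have hy1 : y ∈ φ.target := hy.1
  have e1 := congrArg (fun T => T (mfderiv (𝓡 (2 * n + 1)) (𝓡 (2 * n + 1)) φ.symm y v))
    ((hψ.2 (φ.symm y) hy.2).symm.trans (hφ.2 (φ.symm y) (φ.map_target hy1)))
  have e2 := congrArg (fun T => T v) (hφ.mdifferentiable.comp_symm_deriv hy1)
  rw [hφ.fderiv_transition hψ hy]
  refine e1.trans ?_
  rw [φ.right_inv hy1]
  exact congrArg (stdForm y) e2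

lemma IsAdaptedChart.det_transition_ne_zero {φ ψ : OpenPartialHomeomorph M (Space n)}
    (hφ : IsAdaptedChart η φ) (hψ : IsAdaptedChart η ψ) {y : Space n}
    (hy : y ∈ (φ.symm.trans ψ).source) : (fderiv ℝ (ψ ∘ φ.symm) y).det ≠ 0 := by
  have hy1 : y ∈ φ.target := hy.1
  have hinj : Function.Injective (fderiv ℝ (ψ ∘ φ.symm) y) := by
    intro v w hvw
    rw [hφ.fderiv_transition hψ hy, hφ.fderiv_transition hψ hy] at hvw
    have e1 := fun v => congrArg (fun T => T v) (hψ.mdifferentiable.symm_comp_deriv hy.2)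
    have e2 := fun v => congrArg (fun T => T v) (hφ.mdifferentiable.comp_symm_deriv hy1)
    have h1 := congrArg (mfderiv (𝓡 (2 * n + 1)) (𝓡 (2 * n + 1)) ψ.symm (ψ (φ.symm y))) hvw
    have h2 := ((e1 _).symm.trans h1).trans (e1 _)
    have h3 := congrArg (mfderiv (𝓡 (2 * n + 1)) (𝓡 (2 * n + 1)) φ (φ.symm y)) h2
    exact ((e2 _).symm.trans h3).trans (e2 _)
  have h := LinearMap.ker_eq_bot.mpr hinj
  exact fun h0 => (LinearMap.bot_lt_ker_of_det_eq_zero h0).ne' h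

/-- Boundedness of the transition from one adapted chart to another one, followed by
multiplication with a cutoff function. -/
lemma exists_fsNorm_transition_le (s : ℕ) {φ ψ : OpenPartialHomeomorph M (Space n)}
    (hφ : IsAdaptedChart η φ) (hψ : IsAdaptedChart η ψ) {D D' : Set (Space n)} (hD : IsOpen D)
    (hDc : IsCompact (closure D)) (hDφ : closure D ⊆ φ.target) (hD' : IsOpen D')
    (hDb' : Bornology.IsBounded D') {χ : M → ℝ}
    (hχ : ContMDiff (𝓡 (2 * n + 1)) (modelWithCornersSelf ℝ ℝ) ∞ χ)
    (hsupp : ∀ x ∈ tsupport χ, x ∈ ψ.source ∧ ψ x ∈ D') :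
    ∃ C : ℝ, 0 ≤ C ∧ ∀ f, MemFS D' s f →
      MemFS D s (fun y => χ (φ.symm y) * f (ψ (φ.symm y))) ∧
      fsNorm D s (fun y => χ (φ.symm y) * f (ψ (φ.symm y))) ≤ C * fsNorm D' s f := by
  -- `χ ∘ φ⁻¹` is smooth only on the target of `φ`. The cutoff `θ` extends it by zero to a compactly
  -- supported smooth function, unchanged on `D`.
  obtain ⟨θ, hθ, hθc, hθφ, hθ1⟩ := exists_cutoff hDc φ.open_target hDφ
  set a : Space n → ℝ := fun y => θ y * χ (φ.symm y) with ha
  have hχφ : ContDiffOn ℝ ∞ (fun y => χ (φ.symm y)) φ.target := by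
    rw [← contMDiffOn_iff_contDiffOn]
    exact hχ.comp_contMDiffOn (contMDiffOn_symm_of_mem_maximalAtlas hφ.1)
  have has : ContDiff ℝ ∞ a := by
    refine contDiff_iff_contDiffAt.mpr fun y => ?_
    by_cases hy : y ∈ tsupport θ
    · exact hθ.contDiffAt.mul (hχφ.contDiffAt (φ.open_target.mem_nhds (hθφ hy)))
    · have : a =ᶠ[nhds y] fun _ => 0 := by
        filter_upwards [(isClosed_tsupport θ).isOpen_compl.mem_nhds hy] with z hz
        rw [ha]
        simp only [image_eq_zero_of_notMem_tsupport hz, zero_mul]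
      exact contDiffAt_const.congr_of_eventuallyEq this
  have hL : tsupport a ⊆ tsupport θ ∩ φ.symm ⁻¹' tsupport χ := by
    refine closure_minimal (fun y hy => ?_) ?_
    · have hy' : θ y * χ (φ.symm y) ≠ 0 := hy
      exact ⟨subset_tsupport _ (left_ne_zero_of_mul hy'),
        subset_tsupport _ (right_ne_zero_of_mul hy')⟩
    · exact (φ.continuousOn_symm.mono hθφ).preimage_isClosed_of_isClosed (isClosed_tsupport θ)
        (isClosed_tsupport χ)
  have haW : tsupport a ⊆ (φ.symm.trans ψ).source := fun y hy =>
    ⟨hθφ (hL hy).1, (hsupp _ (hL hy).2).1⟩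
  obtain ⟨C, hC, h⟩ := exists_fsNorm_comp_le s (φ.symm.trans ψ).open_source hD
    (hDc.isBounded.subset subset_closure) hD' hDb' (hφ.contDiffOn_transition hψ)
    (fun y hy v hv => (hφ.stdForm_transition hψ hy v).trans hv) (φ.symm.trans ψ).injOn
    (fun y hy => hφ.det_transition_ne_zero hψ hy) has hθc.mul_right haW
    (fun y hy => (hsupp _ (hL hy).2).2)
  refine ⟨C, hC, fun f hf => ?_⟩
  obtain ⟨h1, h2⟩ := h f hf
  have heq : EqOn (fun y => a y * f ((ψ ∘ φ.symm) y))
      (fun y => χ (φ.symm y) * f (ψ (φ.symm y))) D := fun y hy => by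
    simp [ha, hθ1 y (subset_closure hy)]
  obtain ⟨h3, h4⟩ := h1.congr hD heq
  exact ⟨h3, h4.trans_le h2⟩

lemma AdaptedAtlas.fsNorm_nonneg (A : AdaptedAtlas η) (s : ℕ) (f : M → ℝ) : 0 ≤ A.fsNorm s f :=
  Real.sqrt_nonneg _

lemma AdaptedAtlas.fsNorm_chart_le (A : AdaptedAtlas η) (s : ℕ) (f : M → ℝ) (α : Fin A.card) :
    FollandStein.fsNorm (A.dom α) s (f ∘ (A.chart α).symm) ≤ A.fsNorm s f := by
  refine Real.le_sqrt_of_sq_le ?_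
  exact Finset.single_le_sum
    (f := fun α => FollandStein.fsNorm (A.dom α) s (f ∘ (A.chart α).symm) ^ 2)
    (fun _ _ => sq_nonneg _) (Finset.mem_univ α)

lemma AdaptedAtlas.fsNorm_le_sum (A : AdaptedAtlas η) (s : ℕ) (f : M → ℝ) :
    A.fsNorm s f ≤ ∑ α, FollandStein.fsNorm (A.dom α) s (f ∘ (A.chart α).symm) :=
  Real.sqrt_le_iff.mpr ⟨Finset.sum_nonneg fun _ _ => FollandStein.fsNorm_nonneg _ _ _,
    Finset.sum_sq_le_sq_sum_of_nonneg fun _ _ => FollandStein.fsNorm_nonneg _ _ _⟩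

/-- The global product estimate. -/
theorem AdaptedAtlas.exists_fsNorm_prod_le [T2Space M] [CompactSpace M]
    [IsManifold (modelWithCornersSelf ℝ (Space n)) ((⊤ : ℕ∞) : WithTop ℕ∞) M] (hn : 1 ≤ n)
    {s s' p : ℕ} (hs : s / 2 + (n + 2) ≤ s') (hs' : s' ≤ s) (hp : 1 ≤ p) (A : AdaptedAtlas η) :
    ∃ C : ℝ, 0 < C ∧ ∀ f : Fin p → M → ℝ, (∀ j, A.MemFS s (f j)) →
      A.MemFS s (fun x => ∏ j, f j x) ∧ A.fsNorm s (fun x => ∏ j, f j x) ≤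
        C * ∑ k, A.fsNorm s (f k) * ∏ j ∈ Finset.univ.erase k, A.fsNorm s' (f j) := by
  obtain ⟨χ, hχ⟩ := SmoothPartitionOfUnity.exists_isSubordinate (𝓡 (2 * n + 1))
    (isClosed_univ (X := M)) (fun α => (A.chart α).source ∩ A.chart α ⁻¹' A.dom α)
    (fun α => (A.chart α).isOpen_inter_preimage (A.isOpen_dom α))
    (fun x _ => mem_iUnion.mpr (A.cover x))
  -- The image of the support of `χ β` is compact in `A.dom β`. This leaves room for an intermediate
  -- `D' β`, on which the local estimate applies.
  have hK : ∀ β, ∃ D' : Set (Space n), IsOpen D' ∧ A.chart β '' tsupport (χ β) ⊆ D' ∧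
      closure D' ⊆ A.dom β ∧ IsCompact (closure D') := fun β =>
    exists_open_between_and_isCompact_closure
      ((isClosed_tsupport (χ β)).isCompact.image_of_continuousOn
        ((A.chart β).continuousOn.mono fun x hx => (hχ β hx).1))
      (A.isOpen_dom β) (by
        rintro _ ⟨x, hx, rfl⟩
        exact (hχ β hx).2)
  choose D' hD' hKD' hD'D hD'c using hK
  choose C₁ hC₁ h₁ using fun β => FollandStein.exists_fsNorm_prod_le hn hs hs' hp (hD' β)
    (A.isOpen_dom β) ((A.isCompact_closure β).isBounded.subset subset_closure) (hD'D β)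
  choose C₂ hC₂ h₂ using fun α β => exists_fsNorm_transition_le s (A.adapted α) (A.adapted β)
    (A.isOpen_dom α) (A.isCompact_closure α) (A.closure_subset α) (hD' β)
    ((hD'c β).isBounded.subset subset_closure) (χ β).contMDiff
    (fun x hx => ⟨(hχ β hx).1, hKD' β (mem_image_of_mem _ hx)⟩)
  have hC : 0 ≤ ∑ α, ∑ β, C₂ α β * C₁ β :=
    Finset.sum_nonneg fun α _ => Finset.sum_nonneg fun β _ => mul_nonneg (hC₂ α β) (hC₁ β).le
  refine ⟨∑ α, ∑ β, C₂ α β * C₁ β + 1, by linarith, fun f hf => ?_⟩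
  set S := ∑ k, A.fsNorm s (f k) * ∏ j ∈ Finset.univ.erase k, A.fsNorm s' (f j) with hS
  have hS0 : 0 ≤ S := Finset.sum_nonneg fun _ _ =>
    mul_nonneg (A.fsNorm_nonneg _ _) (Finset.prod_nonneg fun _ _ => A.fsNorm_nonneg _ _)
  have hloc : ∀ β, FollandStein.MemFS (D' β) s (fun y => ∏ j, (f j ∘ (A.chart β).symm) y) ∧
      FollandStein.fsNorm (D' β) s (fun y => ∏ j, (f j ∘ (A.chart β).symm) y) ≤ C₁ β * S := by
    intro β
    obtain ⟨h3, h4⟩ := h₁ β (fun j => f j ∘ (A.chart β).symm) fun j => hf j β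
    refine ⟨h3, h4.trans (mul_le_mul_of_nonneg_left (Finset.sum_le_sum fun k _ => ?_)
      (hC₁ β).le)⟩
    exact mul_le_mul (A.fsNorm_chart_le s (f k) β)
      (Finset.prod_le_prod (fun _ _ => FollandStein.fsNorm_nonneg _ _ _)
        fun j _ => A.fsNorm_chart_le s' (f j) β)
      (Finset.prod_nonneg fun _ _ => FollandStein.fsNorm_nonneg _ _ _) (A.fsNorm_nonneg _ _)
  -- On the support of `χ β` the point lies in the source of chart `β`, so the product may be read
  -- there; elsewhere both sides vanish.
  have hdecomp : ∀ x : M, ∏ j, f j x =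
      ∑ β, χ β x * ∏ j, (f j ∘ (A.chart β).symm) (A.chart β x) := by
    intro x
    have h5 : ∑ β, χ β x = 1 := by
      rw [← finsum_eq_sum_of_fintype]
      exact χ.sum_eq_one (mem_univ x)
    calc ∏ j, f j x = ∑ β, χ β x * ∏ j, f j x := by rw [← Finset.sum_mul, h5, one_mul]
      _ = _ := Finset.sum_congr rfl fun β _ => by
        by_cases hx : x ∈ tsupport (χ β)
        · simp only [Function.comp_apply, (A.chart β).left_inv (hχ β hx).1]
        · rw [image_eq_zero_of_notMem_tsupport hx, zero_mul, zero_mul]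
  have hα : ∀ α, FollandStein.MemFS (A.dom α) s ((fun x => ∏ j, f j x) ∘ (A.chart α).symm) ∧
      FollandStein.fsNorm (A.dom α) s ((fun x => ∏ j, f j x) ∘ (A.chart α).symm) ≤
        (∑ β, C₂ α β * C₁ β) * S := by
    intro α
    have h6 := FollandStein.MemFS.sum (A.isOpen_dom α) fun β => (h₂ α β _ (hloc β).1).1
    have e : (fun x => ∏ j, f j x) ∘ (A.chart α).symm = fun y => ∑ β,
        χ β ((A.chart α).symm y) *
          ∏ j, (f j ∘ (A.chart β).symm) (A.chart β ((A.chart α).symm y)) :=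
      funext fun y => hdecomp _
    rw [e]
    refine ⟨h6.1, h6.2.trans ?_⟩
    rw [Finset.sum_mul]
    refine Finset.sum_le_sum fun β _ => ((h₂ α β _ (hloc β).1).2).trans ?_
    rw [mul_assoc]
    exact mul_le_mul_of_nonneg_left (hloc β).2 (hC₂ α β)
  refine ⟨fun α => (hα α).1, (A.fsNorm_le_sum s _).trans ?_⟩
  calc _ ≤ ∑ α, (∑ β, C₂ α β * C₁ β) * S := Finset.sum_le_sum fun α _ => (hα α).2
    _ = (∑ α, ∑ β, C₂ α β * C₁ β) * S := (Finset.sum_mul _ _ _).symm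
    _ ≤ _ := mul_le_mul_of_nonneg_right (by linarith) hS0

end Contact

/-- For equal orders, the sum in the product estimates is a multiple of the product. -/
lemma sum_mul_prod_erase {p : ℕ} (a : Fin p → ℝ) :
    ∑ k, a k * ∏ j ∈ Finset.univ.erase k, a j = p * ∏ j, a j := by
  rw [Finset.sum_congr rfl fun k _ => Finset.mul_prod_erase _ a (Finset.mem_univ k)]
  simp

end FollandStein

end

/-! ### The local and global product estimates -/

theorem mainTheorem3 (n : ℕ) (hn : 1 ≤ n) (s : ℕ) (hs : 2 * n + 4 ≤ s) (p : ℕ) (hp : 1 ≤ p) :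
    -- the local estimates, on open sets `D' ⋐ D ⋐ ℝ^{2n+1}`
    (∀ D' D : Set (FollandStein.Space n), IsOpen D' → IsOpen D → Bornology.IsBounded D →
      closure D' ⊆ D →
      (∃ C : ℝ, 0 < C ∧ ∀ f : Fin p → FollandStein.Space n → ℝ,
        (∀ j, FollandStein.MemFS D s (f j)) →
          FollandStein.MemFS D' s (fun x => ∏ j, f j x) ∧
          FollandStein.fsNorm D' s (fun x => ∏ j, f j x)
            ≤ C * ∏ j, FollandStein.fsNorm D s (f j)) ∧
      (2 * n + 4 < s → ∃ C : ℝ, 0 < C ∧ ∀ f : Fin p → FollandStein.Space n → ℝ,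
        (∀ j, FollandStein.MemFS D s (f j)) →
          FollandStein.fsNorm D' s (fun x => ∏ j, f j x)
            ≤ C * ∑ j, FollandStein.fsNorm D s (f j) *
                ∏ i ∈ Finset.univ.erase j, FollandStein.fsNorm D (s - 1) (f i))) ∧
    -- the global estimates, on a compact contact manifold `M` with an adapted atlas `A`
    (∀ (M : Type*) [TopologicalSpace M] [T2Space M] [CompactSpace M]
      [ChartedSpace (FollandStein.Space n) M]
      [IsManifold (modelWithCornersSelf ℝ (FollandStein.Space n)) ((⊤ : ℕ∞) : WithTop ℕ∞) M]
      (η : FollandStein.OneForm n M), FollandStein.IsContactForm η →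
      ∀ A : FollandStein.AdaptedAtlas η,
      (∃ C : ℝ, 0 < C ∧ ∀ f : Fin p → M → ℝ,
        (∀ j, A.MemFS s (f j)) →
          A.MemFS s (fun x => ∏ j, f j x) ∧
          A.fsNorm s (fun x => ∏ j, f j x) ≤ C * ∏ j, A.fsNorm s (f j)) ∧
      (2 * n + 4 < s → ∃ C : ℝ, 0 < C ∧ ∀ f : Fin p → M → ℝ,
        (∀ j, A.MemFS s (f j)) →
          A.fsNorm s (fun x => ∏ j, f j x)
            ≤ C * ∑ j, A.fsNorm s (f j) *
                ∏ i ∈ Finset.univ.erase j, A.fsNorm (s - 1) (f i))) := by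
  -- The thresholds for `s` enter here: the Sobolev order `s / 2 + (n + 2)` fits below `s`, and in
  -- the strict case below `s - 1`. The division rounds down, which matters for odd `s` such as `2n
  -- + 5`.
  have h1 : s / 2 + (n + 2) ≤ s := by omega
  have h2 : 2 * n + 4 < s → s / 2 + (n + 2) ≤ s - 1 := fun h => by omega
  have h3 : (0 : ℝ) < p := by exact_mod_cast hp
  refine ⟨fun D' D hD' hD hDb hsub => ⟨?_, fun hs2 => ?_⟩,
    fun M _ _ _ _ _ η _ A => ⟨?_, fun hs2 => ?_⟩⟩
  · obtain ⟨C, hC, h⟩ := FollandStein.exists_fsNorm_prod_le hn h1 le_rfl hp hD' hD hDb hsub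
    -- With `s' = s` all `p` summands of the general estimate coincide, whence the factor `p`.
    refine ⟨C * p, mul_pos hC h3, fun f hf => ⟨(h f hf).1, (h f hf).2.trans (le_of_eq ?_)⟩⟩
    rw [FollandStein.sum_mul_prod_erase, mul_assoc]
  · obtain ⟨C, hC, h⟩ := FollandStein.exists_fsNorm_prod_le hn (h2 hs2) (Nat.sub_le s 1) hp
      hD' hD hDb hsub
    exact ⟨C, hC, fun f hf => (h f hf).2⟩
  · obtain ⟨C, hC, h⟩ := A.exists_fsNorm_prod_le hn h1 le_rfl hp
    refine ⟨C * p, mul_pos hC h3, fun f hf => ⟨(h f hf).1, (h f hf).2.trans (le_of_eq ?_)⟩⟩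
    rw [FollandStein.sum_mul_prod_erase, mul_assoc]
  · obtain ⟨C, hC, h⟩ := A.exists_fsNorm_prod_le hn (h2 hs2) (Nat.sub_le s 1) hp
    exact ⟨C, hC, fun f hf => (h f hf).2⟩
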